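/- Let $\{Z_n\}_{n\ge 0}$ be an irreducible aperiodic Markov chain on $\{1,\dots,N\}$ with transition matrix $(p_{i,j})$ and stationary distribution $\pi$. Let $W_0\ge 0$ and $$W_{n+1}=[V_nW_n+S_n-A_{n+1}]^+,\qquad n\ge 0,$$ where, given the past ($W_0$; $Z_r$, $r\le n$; $V_r,S_r,A_{r+1}$, $r<n$) with $Z_n=i$, the variable $V_n$ is independent of $(S_n,Z_{n+1},A_{n+1})$ and has a fixed law $F_V$ with $F_V((-\infty,0))=1$, and $$P(A_{n+1}\le x,\,S_n\le y,\,Z_{n+1}=j\mid Z_n=i)=p_{i,j}F_{S,i}(y)G_{A,j}(x),$$ with $F_{S,i},G_{A,j}$ distribution functions of nonnegative random variables. Assume that $P(S_n<A_{n+1},Z_{n+1}=l\mid Z_n=i)>0$ for some $i,l$. Put $\Phi_{A,j}(s)=\int_0^\infty e^{-sx}\,dG_{A,j}(x)$. Assume that for $\mathrm{Re}\,s\ge 0$ $$\int_0^\infty e^{-sx}\,dF_{S,i}(x)=\frac{N_{B,i}(s)}{D_{B,i}(s)},\qquad D_{B,i}(s)=\prod_{f=1}^{m_i}(s-t_{f,i}),\quad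 \mathrm{Re}\,t_{f,i}<0,$$ with $N_{B,i}$ a polynomial. No rationality is assumed for $A$. Let $m=\sum_{k=1}^N m_k$. Then the Markov chain $(W_n,Z_n)$ has exactly one stationary law, and, with $\Phi_{W,j}(s)=E(e^{-sW}1_{\{Z=j\}})$ for $(W,Z)$ distributed according to it, $E(e^{-sW_n}1_{\{Z_n=j\}})\to\Phi_{W,j}(s)$ as $n\to\infty$ for all $j$ and all $s$ with $\mathrm{Re}\,s\ge 0$. There are complex numbers $c_{\omega,j}$, $0\le\omega\le m$, $1\le j\le N$, such that $$\Phi_{W,j}(s)=\frac{\sum_{\omega=0}^{m}c_{\omega,j}s^\omega}{\prod_{k=1}^N D_{B,k}(s)},\qquad \mathrm{Re}\,s\ge 0,\ j=1,\dots,N,$$ with $c_{0,j}=\pi_j\prod_{k=1}^N D_{B,k}(0)$, and such that for all $k$, all $f=1,\dots,m_k$ and all $j$, with $t=t_{f,k}$, $$\Phi_{A,j}(-t)\sum_{i=1}^N p_{i,j}N_{B,i}(t)\prod_{\nu\ne i}D_{B,\nu}(t)\int_{(-\infty,0)}\frac{\sum_{\omega=0}^{m}c_{\omega,i}(ty)^\omega}{\prod_{l=1}^N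 D_{B,l}(ty)}\,F_V(dy)=\sum_{\omega=0}^{m}c_{\omega,j}t^\omega .$$ If the $m$ numbers $t_{f,k}$ are pairwise distinct, then these linear equations together with the values of $c_{0,j}$ determine all the $c_{\omega,j}$ uniquely. -/

import Mathlib

open MeasureTheory Filter Topology

noncomputable section

namespace MarkovLindley

/-- The data of the Markov-modulated recursion `W (n+1) = [V n * W n + S n - A (n+1)]⁺` on the
background state space `Fin N`: the transition matrix of the background chain, the common law of
the multipliers `V n`, the law `lawS i` of `S n` given `Z n = i`, and the law `lawA j` of `A (n+1)`
given `Z (n+1) = j`. The variables `S` and `A` are nonnegative. -/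
structure Model (N : ℕ) where
  P : Matrix (Fin N) (Fin N) ℝ
  lawV : Measure ℝ
  lawS : Fin N → Measure ℝ
  lawA : Fin N → Measure ℝ
  stochastic : P ∈ Matrix.rowStochastic ℝ (Fin N)
  prob_V : IsProbabilityMeasure lawV
  prob_S : ∀ i, IsProbabilityMeasure (lawS i)
  prob_A : ∀ j, IsProbabilityMeasure (lawA j)
  nonneg_S : ∀ i, ∀ᵐ x ∂(lawS i), 0 ≤ x
  nonneg_A : ∀ j, ∀ᵐ x ∂(lawA j), 0 ≤ x

/-- Aperiodicity of a stochastic matrix: for every state, the possible return times have greatest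
common divisor `1`. -/
def Aperiodic {N : ℕ} (P : Matrix (Fin N) (Fin N) ℝ) : Prop :=
  ∀ i : Fin N, ∀ d : ℕ, (∀ n : ℕ, 0 < n → 0 < (P ^ n) i i → d ∣ n) → d = 1

/-- `p` is a stationary distribution of the stochastic matrix `P`. -/
def IsStationaryVector {N : ℕ} (P : Matrix (Fin N) (Fin N) ℝ) (p : Fin N → ℝ) : Prop :=
  p ∈ stdSimplex ℝ (Fin N) ∧ Matrix.vecMul p P = p

/-- The past before step `n`: the sigma-algebra generated by `W 0`, by `Z r` for `r ≤ n`, and by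
`V r`, `S r`, `A (r+1)` for `r < n`. -/
abbrev past {Ω : Type*} {N : ℕ} (W : ℕ → Ω → ℝ) (Z : ℕ → Ω → Fin N) (V S A : ℕ → Ω → ℝ) (n : ℕ) :
    MeasurableSpace Ω :=
  MeasurableSpace.comap (W 0) inferInstance
    ⊔ (⨆ r : ℕ, ⨆ _ : r ≤ n, MeasurableSpace.comap (Z r) inferInstance)
    ⊔ (⨆ r : ℕ, ⨆ _ : r < n,
        MeasurableSpace.comap (fun ω => (V r ω, S r ω, A (r + 1) ω)) inferInstance)

/-- The random variables `W, Z, V, S, A` on the probability space `(Ω, μ)` form the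
Markov-modulated recursion with data `M`, started from some `W 0 ≥ 0`. Field `step_law` says that,
given the past before step `n`, with `Z n = i`, the law of `(V n, S n, Z (n+1), A (n+1))` is
`lawV(dv) * lawS i (dx) * P i j * lawA j (dy)`. -/
structure IsProcess {Ω : Type*} [MeasurableSpace Ω] {N : ℕ} (M : Model N) (μ : Measure Ω)
    (W : ℕ → Ω → ℝ) (Z : ℕ → Ω → Fin N) (V S A : ℕ → Ω → ℝ) : Prop where
  measurable_W : ∀ n, Measurable (W n)
  measurable_Z : ∀ n, Measurable (Z n)
  measurable_V : ∀ n, Measurable (V n)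
  measurable_S : ∀ n, Measurable (S n)
  measurable_A : ∀ n, Measurable (A n)
  nonneg_init : ∀ᵐ ω ∂μ, 0 ≤ W 0 ω
  recursion : ∀ n ω, W (n + 1) ω = max (V n ω * W n ω + S n ω - A (n + 1) ω) 0
  step_law : ∀ (n : ℕ) (i j : Fin N) (H : Set Ω) (BV BS BA : Set ℝ),
    MeasurableSet[past W Z V S A n] H →
    MeasurableSet BV → MeasurableSet BS → MeasurableSet BA →
    μ (H ∩ {ω | Z n ω = i ∧ V n ω ∈ BV ∧ S n ω ∈ BS ∧ Z (n + 1) ω = j ∧ A (n + 1) ω ∈ BA})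
      = μ (H ∩ {ω | Z n ω = i})
          * (M.lawV BV * M.lawS i BS * ENNReal.ofReal (M.P i j) * M.lawA j BA)

/-- The law of `(W (n+1), Z (n+1))` given `W n = x.1` and `Z n = x.2`. -/
def Model.step {N : ℕ} (M : Model N) (x : ℝ × Fin N) : Measure (ℝ × Fin N) :=
  ∑ j : Fin N, ENNReal.ofReal (M.P x.2 j) •
    Measure.map (fun u : ℝ × ℝ × ℝ => (max (u.1 * x.1 + u.2.1 - u.2.2) 0, j))
      (M.lawV.prod ((M.lawS x.2).prod (M.lawA j)))

/-- `ν` is a stationary law of the Markov chain `(W n, Z n)`. -/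
def Model.IsStationaryLaw {N : ℕ} (M : Model N) (ν : Measure (ℝ × Fin N)) : Prop :=
  IsProbabilityMeasure ν ∧
    ∀ B : Set (ℝ × Fin N), MeasurableSet B → ν B = ∫⁻ x, M.step x B ∂ν

/-- The Laplace-Stieltjes transform of a law on `[0, ∞)`. -/
def lst (ρ : Measure ℝ) (s : ℂ) : ℂ :=
  ∫ x, Complex.exp (-s * (x : ℂ)) ∂ρ

/-- `E (exp (-s * W n) ; Z n = j)`. -/
def transform {Ω : Type*} [MeasurableSpace Ω] {N : ℕ} (μ : Measure Ω)
    (W : ℕ → Ω → ℝ) (Z : ℕ → Ω → Fin N) (n : ℕ) (j : Fin N) (s : ℂ) : ℂ :=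
  ∫ ω in {ω | Z n ω = j}, Complex.exp (-s * (W n ω : ℂ)) ∂μ

/-- `E (exp (-s * W) ; Z = j)` when `(W, Z)` has law `ν`. -/
def lawTransform {N : ℕ} (ν : Measure (ℝ × Fin N)) (j : Fin N) (s : ℂ) : ℂ :=
  ∫ x in {x : ℝ × Fin N | x.2 = j}, Complex.exp (-s * (x.1 : ℂ)) ∂ν

/-- The monic denominator `∏ f, (s - t k f)` of the transform of `S` in state `k`. -/
def denom {N : ℕ} {m : Fin N → ℕ} (t : (k : Fin N) → Fin (m k) → ℂ) (k : Fin N) (s : ℂ) : ℂ :=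
  ∏ f : Fin (m k), (s - t k f)

/-- The transform of `S` in state `i` is the rational function `num i / denom t i` on the closed
right half-plane, and all zeros of the denominator have negative real part. (Numerator and
denominator are not required to be coprime.) -/
def HasRationalService {N : ℕ} (M : Model N) (num : Fin N → Polynomial ℂ) {m : Fin N → ℕ}
    (t : (k : Fin N) → Fin (m k) → ℂ) : Prop :=
  (∀ k f, (t k f).re < 0) ∧
    ∀ (i : Fin N) (s : ℂ), 0 ≤ s.re → lst (M.lawS i) s = (num i).eval s / denom t i s

/-- The polynomial `∑ ω, c j ω * s ^ ω`, with `ω` from `0` to `∑ k, m k`. -/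
def numer {N : ℕ} {m : Fin N → ℕ} (c : Fin N → Fin ((∑ k, m k) + 1) → ℂ) (j : Fin N) (s : ℂ) : ℂ :=
  ∑ ω : Fin ((∑ k, m k) + 1), c j ω * s ^ (ω : ℕ)

/-- The linear system for the coefficients `c`: one equation for each zero `t k f` and each
state `j`. -/
def PoleSystem {N : ℕ} (M : Model N) (num : Fin N → Polynomial ℂ) {m : Fin N → ℕ}
    (t : (k : Fin N) → Fin (m k) → ℂ) (c : Fin N → Fin ((∑ k, m k) + 1) → ℂ) : Prop :=
  ∀ (k : Fin N) (f : Fin (m k)) (j : Fin N),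
    lst (M.lawA j) (-(t k f)) *
        ∑ i : Fin N, (M.P i j : ℂ) * (num i).eval (t k f)
          * (∏ l ∈ Finset.univ.erase i, denom t l (t k f))
          * ∫ y in Set.Iio (0 : ℝ),
              numer c i (t k f * (y : ℂ)) / ∏ l : Fin N, denom t l (t k f * (y : ℂ)) ∂M.lawV
      = numer c j (t k f)

end MarkovLindley

end

/-!
The chain `(W, Z)` has one stationary law, and its transform is rational, for the following reasons.

*Ergodicity.* After one step the level is nonnegative, and then, since `V < 0`, on the event `S < A`
the next level is `0`. The background matrix is primitive, so it reaches a state `i` from which this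
can happen within a fixed number of steps, with a probability bounded below. Hence some iterate of
the kernel charges the atom `(0, l)` with a probability bounded below uniformly in the starting
point (`Model.exists_doeblin`). This Doeblin condition gives an invariant law, its uniqueness, and
uniform convergence of the iterates of every bounded function, without any moment assumption.

*Rationality.* Let `X = V W + S - A` be the new level before taking the positive part `X⁺`, and `X⁻`
its negative part. On the imaginary axis `exp (-s X⁺) = 1 + exp (-s X) - exp (s X⁻)`, and the
transform of `X` factorizes into the transforms of `V W`, `S` and `-A`. Multiplied by the product of
the denominators, the left side is holomorphic in the right half-plane; because `V < 0` and `S` has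
a rational transform, the right side is holomorphic in the left half-plane. Both grow at most
polynomially, so by the theorems of Morera and Liouville they are restrictions of one polynomial
(`exists_polynomial_of_glue`), of degree at most `∑ k, m k`. At a zero `t` of a denominator the
terms `1` and `exp (s X⁻)` drop out, which gives the value of this polynomial at `t`
(`Model.exists_numerator`). For the stationary law, which is reproduced by one step, this is the
rational formula together with the linear equations.

*Uniqueness of the coefficients.* If the zeros are distinct, any solution of the linear equations
is, by partial fractions, the transform of a complex measure with atoms at the level `0` and a
density that is a sum of exponentials (`stateTransform_refDensity`). One step of the chain replaces
its numerators by polynomials of degree at most `∑ k, m k` that agree with them at the `∑ k, m k`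
zeros and at `0`, hence changes nothing. So the complex measure and its image after one step have
the same transform. Combinations of the functions `exp (-k w)` are uniformly dense in the functions
of the level `w ≥ 0` that are continuous up to `w = ∞`, and one step of the chain preserves this
class of functions, so the transition operator can be iterated inside the integral; by the Doeblin
convergence the complex measure has the transform of the stationary law
(`integral_eq_of_expTest`, `PoleSystem.numer_eq`).
-/


namespace MarkovLindley

/-! ### Primitivity of the background chain -/

/-- A product of two positive entries of powers of a nonnegative matrix is a lower bound for an
entry of the product. -/
lemma pow_add_apply_pos {N : ℕ} {P : Matrix (Fin N) (Fin N) ℝ} (hP : ∀ i j, 0 ≤ P i j)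
    {a b : ℕ} {i k j : Fin N} (h₁ : 0 < (P ^ a) i k) (h₂ : 0 < (P ^ b) k j) :
    0 < (P ^ (a + b)) i j := by
  rw [pow_add, Matrix.mul_apply]
  exact Finset.sum_pos' (fun l _ => mul_nonneg (Matrix.pow_apply_nonneg hP a i l)
    (Matrix.pow_apply_nonneg hP b l j)) ⟨k, Finset.mem_univ k, mul_pos h₁ h₂⟩

/-- The return times of a state form an additive semigroup of natural numbers; if it has greatest
common divisor `1`, it contains all large numbers. -/
lemma eventually_pow_pos {N : ℕ} {P : Matrix (Fin N) (Fin N) ℝ} (hirr : P.IsIrreducible)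
    (haper : Aperiodic P) : ∀ᶠ n in atTop, ∀ i j, 0 < (P ^ n) i j := by
  have hP := hirr.nonneg
  have hconn := (Matrix.isIrreducible_iff_exists_pow_pos hP).1 hirr
  have hdiag : ∀ i, ∃ n₀, ∀ n ≥ n₀, 0 < (P ^ n) i i := by
    intro i
    set s : Set ℕ := {n | 0 < n ∧ 0 < (P ^ n) i i} with hs
    have h1 : Nat.setGcd s = 1 :=
      haper i _ fun n hn hn' => Nat.setGcd_dvd_of_mem (show n ∈ s from ⟨hn, hn'⟩)
    obtain ⟨n₀, h⟩ := Nat.exists_mem_closure_of_ge s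
    refine ⟨n₀, fun n hn => ?_⟩
    have hmem := h n hn (by rw [h1]; exact one_dvd n)
    clear hn
    induction hmem using AddSubmonoid.closure_induction with
    | mem x hx => exact hx.2
    | zero => simp
    | add x y _ _ hx hy => exact pow_add_apply_pos hP hx hy
  simp only [eventually_all]
  intro i j
  obtain ⟨k, -, hk⟩ := hconn i j
  obtain ⟨n₀, h⟩ := hdiag i
  filter_upwards [eventually_ge_atTop (n₀ + k)] with n hn
  obtain ⟨d, rfl⟩ := Nat.exists_eq_add_of_le (show k ≤ n by omega)
  rw [add_comm]
  exact pow_add_apply_pos hP (h d (by omega)) hk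

/-! ### Uniform ergodicity of Markov kernels with an atom -/

section Doeblin

open ProbabilityTheory

variable {E : Type*} [MeasurableSpace E]

/-- The transition operator of a kernel, on real functions. -/
noncomputable def transOp (κ : Kernel E E) (g : E → ℝ) (x : E) : ℝ := ∫ y, g y ∂κ x

lemma integrable_of_bounds {α : Measure E} [IsFiniteMeasure α] {g : E → ℝ} (hg : Measurable g)
    {a b : ℝ} (hab : ∀ x, g x ∈ Set.Icc a b) : Integrable g α :=
  Integrable.of_mem_Icc a b hg.aemeasurable (.of_forall hab)

lemma measurable_transOp {κ : Kernel E E} {g : E → ℝ}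
    (hg : Measurable g) : Measurable (transOp κ g) :=
  (hg.stronglyMeasurable.integral_kernel (κ := κ)).measurable

lemma bind_mono_left {κ : Kernel E E} {α β : Measure E} (h : α ≤ β) :
    α.bind κ ≤ β.bind κ := by
  refine Measure.le_iff.2 fun s hs => ?_
  rw [Measure.bind_apply hs κ.aemeasurable, Measure.bind_apply hs κ.aemeasurable]
  exact lintegral_mono' h le_rfl

lemma indicator_singleton_mem_Icc {E : Type*} {z : E} (x : E) :
    Set.indicator {z} (1 : E → ℝ) x ∈ Set.Icc (0 : ℝ) 1 := by
  by_cases h : x = z <;> simp [h]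

/-- The law after `k` steps of the chain started in `z` and killed when it returns to `z`. -/
noncomputable def tabooLaw (κ : Kernel E E) (z : E) (k : ℕ) : Measure E :=
  (fun β : Measure E => (β.bind κ).restrict {z}ᶜ)^[k] (Measure.dirac z)

lemma tabooLaw_succ {κ : Kernel E E} {z : E} (k : ℕ) :
    tabooLaw κ z (k + 1) = ((tabooLaw κ z k).bind κ).restrict {z}ᶜ := by
  simp only [tabooLaw, Function.iterate_succ_apply']

lemma measurable_iterate_transOp {κ : Kernel E E} {g : E → ℝ} (hg : Measurable g)
    (n : ℕ) : Measurable ((transOp κ)^[n] g) := by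
  induction n with
  | zero => exact hg
  | succ n ih => rw [Function.iterate_succ_apply']; exact measurable_transOp ih

lemma tabooLaw_add_le {κ : Kernel E E} {z : E} (j k : ℕ) :
    tabooLaw κ z (j + k) ≤ (fun β : Measure E => β.bind κ)^[k] (tabooLaw κ z j) := by
  induction k with
  | zero => exact le_rfl
  | succ k ih =>
    rw [← add_assoc, tabooLaw_succ, Function.iterate_succ_apply']
    exact Measure.restrict_le_self.trans (bind_mono_left ih)

variable {κ : Kernel E E} [IsMarkovKernel κ]

lemma iterate_bind_univ (α : Measure E) (k : ℕ) :
    ((fun β : Measure E => β.bind κ)^[k] α) Set.univ = α Set.univ := by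
  induction k with
  | zero => rfl
  | succ k ih =>
    rw [Function.iterate_succ_apply', Measure.bind_apply .univ κ.aemeasurable]
    simpa using ih

lemma transOp_mem_Icc {g : E → ℝ} (hg : Measurable g) {a b : ℝ}
    (hab : ∀ x, g x ∈ Set.Icc a b) (x : E) : transOp κ g x ∈ Set.Icc a b := by
  have hi := integrable_of_bounds (α := κ x) hg hab
  constructor
  · have := integral_mono (integrable_const a) hi fun y => (hab y).1
    simpa [transOp] using this
  · have := integral_mono hi (integrable_const b) fun y => (hab y).2
    simpa [transOp] using this

lemma iterate_transOp_mem_Icc {g : E → ℝ} (hg : Measurable g) {a b : ℝ}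
    (hab : ∀ x, g x ∈ Set.Icc a b) (n : ℕ) (x : E) : (transOp κ)^[n] g x ∈ Set.Icc a b := by
  induction n generalizing x with
  | zero => exact hab x
  | succ n ih =>
    rw [Function.iterate_succ_apply']
    exact transOp_mem_Icc (measurable_iterate_transOp hg n) ih x

lemma integral_bind_of_integrable {G : Type*} [NormedAddCommGroup G] [NormedSpace ℝ G]
    {κ : Kernel E E} {α : Measure E} {f : E → G} (hf : Integrable f (α.bind κ)) :
    ∫ x, f x ∂(α.bind κ) = ∫ x, ∫ y, f y ∂κ x ∂α := by
  have h : α.bind κ = (κ ∘ₖ Kernel.const Unit α) () := by rw [Kernel.comp_apply]; rfl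
  rw [h] at hf ⊢
  rw [Kernel.integral_comp hf]
  rfl

lemma integral_bind_kernel {α : Measure E} [IsFiniteMeasure α] {g : E → ℝ} (hg : Measurable g)
    {a b : ℝ} (hab : ∀ x, g x ∈ Set.Icc a b) : ∫ x, g x ∂(α.bind κ) = ∫ x, transOp κ g x ∂α :=
  integral_bind_of_integrable (integrable_of_bounds hg hab)

lemma integral_iterate_bind {α : Measure E} [IsFiniteMeasure α] {g : E → ℝ} (hg : Measurable g)
    {a b : ℝ} (hab : ∀ x, g x ∈ Set.Icc a b) (n : ℕ) :
    IsFiniteMeasure ((fun β : Measure E => β.bind κ)^[n] α) ∧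
    ∫ x, g x ∂((fun β : Measure E => β.bind κ)^[n] α) = ∫ x, (transOp κ)^[n] g x ∂α := by
  induction n generalizing α with
  | zero => exact ⟨‹_›, rfl⟩
  | succ n ih =>
    rw [Function.iterate_succ_apply]
    have h := ih (α := α.bind κ)
    refine ⟨h.1, h.2.trans ?_⟩
    rw [integral_bind_kernel (measurable_iterate_transOp hg n) (iterate_transOp_mem_Icc hg hab n),
      Function.iterate_succ_apply']

lemma iterate_transOp_affine {g : E → ℝ} (hg : Measurable g) {a b : ℝ}
    (hab : ∀ x, g x ∈ Set.Icc a b) (c d : ℝ) (n : ℕ) :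
    (transOp κ)^[n] (fun x => c * g x + d) = fun x => c * (transOp κ)^[n] g x + d := by
  induction n with
  | zero => rfl
  | succ n ih =>
    rw [Function.iterate_succ_apply', ih, Function.iterate_succ_apply']
    funext x
    have hi := integrable_of_bounds (α := κ x) (measurable_iterate_transOp (κ := κ) hg n)
      (iterate_transOp_mem_Icc hg hab n)
    simp only [transOp]
    rw [integral_add (hi.const_mul c) (integrable_const d), integral_const_mul]
    simp

lemma transOp_mono {g h : E → ℝ} (hg : Measurable g) (hh : Measurable h) {a b a' b' : ℝ}
    (hab : ∀ x, g x ∈ Set.Icc a b) (hab' : ∀ x, h x ∈ Set.Icc a' b') (hgh : ∀ x, g x ≤ h x)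
    (x : E) : transOp κ g x ≤ transOp κ h x :=
  integral_mono (integrable_of_bounds hg hab) (integrable_of_bounds hh hab') hgh

lemma iterate_transOp_mono {g h : E → ℝ} (hg : Measurable g) (hh : Measurable h) {a b a' b' : ℝ}
    (hab : ∀ x, g x ∈ Set.Icc a b) (hab' : ∀ x, h x ∈ Set.Icc a' b') (hgh : ∀ x, g x ≤ h x)
    (n : ℕ) (x : E) : (transOp κ)^[n] g x ≤ (transOp κ)^[n] h x := by
  induction n generalizing x with
  | zero => exact hgh x
  | succ n ih =>
    simp only [Function.iterate_succ_apply']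
    exact transOp_mono (measurable_iterate_transOp hg n) (measurable_iterate_transOp hh n)
      (iterate_transOp_mem_Icc hg hab n) (iterate_transOp_mem_Icc hh hab' n) ih x

/-- The Doeblin minorization: from every starting point, the atom `z` carries mass at least `ε`
after `n` steps. -/
def Doeblin (κ : Kernel E E) (z : E) (n : ℕ) (ε : ℝ) : Prop :=
  0 < ε ∧ ε ≤ 1 ∧ ∀ x, ε ≤ (transOp κ)^[n] (Set.indicator {z} 1) x

variable [MeasurableSingletonClass E] {z : E} {n : ℕ} {ε : ℝ}

lemma measurable_indicator_singleton : Measurable (Set.indicator {z} (1 : E → ℝ)) :=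
  measurable_one.indicator (measurableSet_singleton z)

/-- Since `g - a ≥ (g z - a) 1_z`, the minorization moves the lower bound of a function towards its
value at the atom, and likewise the upper bound. -/
lemma Doeblin.iterate_mem_Icc (hD : Doeblin κ z n ε) {g : E → ℝ} (hg : Measurable g) {a b : ℝ}
    (hab : ∀ x, g x ∈ Set.Icc a b) (x : E) :
    (transOp κ)^[n] g x ∈ Set.Icc (a + ε * (g z - a)) (b - ε * (b - g z)) := by
  have hz := hab z
  have hind := hD.2.2 x
  have h1 := iterate_transOp_affine (κ := κ) (measurable_indicator_singleton (z := z))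
    indicator_singleton_mem_Icc (g z - a) a n
  have h2 := iterate_transOp_affine (κ := κ) (measurable_indicator_singleton (z := z))
    indicator_singleton_mem_Icc (g z - b) b n
  constructor
  · have hm := iterate_transOp_mono (κ := κ)
      (g := fun x => (g z - a) * Set.indicator {z} (1 : E → ℝ) x + a) (h := g)
      ((measurable_indicator_singleton.const_mul _).add_const _) hg (a := a) (b := b)
      (fun x => by by_cases h : x = z <;> simp [h, hz.1, hz.2, hz.1.trans hz.2]) hab
      (fun x => by by_cases h : x = z <;> simp [h, (hab x).1]) n x
    rw [h1] at hm
    nlinarith [hz.1]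
  · have hm := iterate_transOp_mono (κ := κ)
      (h := fun x => (g z - b) * Set.indicator {z} (1 : E → ℝ) x + b) (g := g) hg
      ((measurable_indicator_singleton.const_mul _).add_const _) hab (a' := a) (b' := b)
      (fun x => by by_cases h : x = z <;> simp [h, hz.1, hz.2, hz.1.trans hz.2])
      (fun x => by by_cases h : x = z <;> simp [h, (hab x).2]) n x
    rw [h2] at hm
    nlinarith [hz.2]

/-- Under the minorization the oscillation of the iterates decays geometrically. -/
lemma Doeblin.exists_Icc (hD : Doeblin κ z n ε) {g : E → ℝ} (hg : Measurable g) {a b : ℝ}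
    (hab : ∀ x, g x ∈ Set.Icc a b) (k : ℕ) :
    ∃ c : ℝ, ∀ x, (transOp κ)^[n * k] g x ∈ Set.Icc c (c + (1 - ε) ^ k * (b - a)) := by
  induction k with
  | zero => exact ⟨a, fun x => by simpa using hab x⟩
  | succ k ih =>
    obtain ⟨c, hc⟩ := ih
    refine ⟨c + ε * ((transOp κ)^[n * k] g z - c), fun x => ?_⟩
    have := hD.iterate_mem_Icc (measurable_iterate_transOp hg (n * k)) hc x
    rw [← Function.iterate_add_apply, show n + n * k = n * (k + 1) by ring] at this
    refine ⟨this.1, this.2.trans (le_of_eq ?_)⟩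
    ring

/-- If `ν` is invariant, the iterates of a bounded function converge uniformly to its `ν`-mean. -/
lemma Doeblin.tendstoUniformly (hD : Doeblin κ z n ε) {ν : Measure E} [IsProbabilityMeasure ν]
    (hν : ν.bind κ = ν) {g : E → ℝ} (hg : Measurable g) {a b : ℝ}
    (hab : ∀ x, g x ∈ Set.Icc a b) {δ : ℝ} (hδ : 0 < δ) :
    ∀ᶠ k in atTop, ∀ x, |(transOp κ)^[k] g x - ∫ y, g y ∂ν| ≤ δ := by
  have hlim : Tendsto (fun k : ℕ => (1 - ε) ^ k * (b - a)) atTop (𝓝 0) := by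
    have h := tendsto_pow_atTop_nhds_zero_of_lt_one (sub_nonneg.2 hD.2.1)
      (sub_lt_self 1 hD.1)
    simpa using h.mul_const (b - a)
  obtain ⟨k₀, hk₀⟩ := (hlim.eventually (ge_mem_nhds hδ)).exists
  filter_upwards [eventually_ge_atTop (n * k₀)] with k hk x
  obtain ⟨d, rfl⟩ := Nat.exists_eq_add_of_le hk
  obtain ⟨c, hc⟩ := hD.exists_Icc hg hab k₀
  have hc' : ∀ x, (transOp κ)^[n * k₀ + d] g x ∈ Set.Icc c (c + (1 - ε) ^ k₀ * (b - a)) := by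
    intro x
    rw [add_comm (n * k₀) d, Function.iterate_add_apply]
    exact iterate_transOp_mem_Icc (κ := κ) (measurable_iterate_transOp hg _) hc d x
  have hfix : (fun β : Measure E => β.bind κ)^[n * k₀ + d] ν = ν :=
    Function.iterate_fixed (f := fun β : Measure E => β.bind κ) hν _
  have hint := (integral_iterate_bind (κ := κ) (α := ν) hg hab (n * k₀ + d)).2
  rw [hfix] at hint
  have hi := integrable_of_bounds (α := ν) (measurable_iterate_transOp (κ := κ) hg (n * k₀ + d)) hc'
  have h1 := integral_mono (integrable_const c) hi fun y => (hc' y).1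
  have h2 := integral_mono hi (integrable_const _) fun y => (hc' y).2
  simp only [integral_const, probReal_univ, one_smul, ← hint] at h1 h2
  rw [abs_le]
  constructor <;> linarith [(hc' x).1, (hc' x).2]

/-- Convergence of the iterates, integrated against a probability measure. -/
lemma Doeblin.tendsto_integral (hD : Doeblin κ z n ε) {ν : Measure E} [IsProbabilityMeasure ν]
    (hν : ν.bind κ = ν) (α : Measure E) [IsProbabilityMeasure α] {g : E → ℝ} (hg : Measurable g)
    {a b : ℝ} (hab : ∀ x, g x ∈ Set.Icc a b) :
    Tendsto (fun k => ∫ x, (transOp κ)^[k] g x ∂α) atTop (𝓝 (∫ x, g x ∂ν)) := by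
  rw [Metric.tendsto_atTop']
  intro δ hδ
  obtain ⟨k₀, hk₀⟩ := eventually_atTop.1 (hD.tendstoUniformly hν hg hab (half_pos hδ))
  refine ⟨k₀, fun k hk => ?_⟩
  have hi := integrable_of_bounds (α := α) (measurable_iterate_transOp (κ := κ) hg k)
    (iterate_transOp_mem_Icc hg hab k)
  have h : ∫ x, ((transOp κ)^[k] g x - ∫ y, g y ∂ν) ∂α
      = (∫ x, (transOp κ)^[k] g x ∂α) - ∫ y, g y ∂ν := by
    rw [integral_sub hi (integrable_const _)]; simp
  rw [Real.dist_eq, ← h, ← Real.norm_eq_abs]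
  refine (norm_integral_le_of_norm_le_const (C := δ / 2)
    (.of_forall fun x => hk₀ k hk.le x)).trans_lt ?_
  simpa using hδ

lemma Doeblin.invariant_unique (hD : Doeblin κ z n ε) {ν ν' : Measure E} [IsProbabilityMeasure ν]
    [IsProbabilityMeasure ν'] (hν : ν.bind κ = ν) (hν' : ν'.bind κ = ν') : ν' = ν := by
  ext B hB
  have hm : Measurable (Set.indicator B (1 : E → ℝ)) := measurable_one.indicator hB
  have hab : ∀ x, Set.indicator B (1 : E → ℝ) x ∈ Set.Icc (0 : ℝ) 1 := fun x => by
    by_cases h : x ∈ B <;> simp [h]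
  have hlim := hD.tendsto_integral hν ν' hm hab
  have hlim' := hD.tendsto_integral hν' ν' hm hab
  have := tendsto_nhds_unique hlim' hlim
  rwa [integral_indicator_one hB, integral_indicator_one hB, measureReal_eq_measureReal_iff] at this

instance isFiniteMeasure_tabooLaw (k : ℕ) : IsFiniteMeasure (tabooLaw κ z k) := by
  induction k with
  | zero => simp only [tabooLaw, Function.iterate_zero, id]; infer_instance
  | succ k ih => rw [tabooLaw_succ]; infer_instance

/-- Within `n` steps the chain visits the atom with probability at least `ε`, so the mass of the
killed chain decays geometrically. -/
lemma Doeblin.tabooLaw_real_le (hD : Doeblin κ z n ε) (hn : n ≠ 0) (j : ℕ) :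
    (tabooLaw κ z (j + n)).real Set.univ ≤ (1 - ε) * (tabooLaw κ z j).real Set.univ := by
  obtain ⟨hfin, hint⟩ := integral_iterate_bind (κ := κ) (α := tabooLaw κ z j)
    (measurable_indicator_singleton (z := z)) indicator_singleton_mem_Icc n
  set β := (fun β : Measure E => β.bind κ)^[n] (tabooLaw κ z j)
  have hcompl : (tabooLaw κ z (j + n)).real Set.univ = (tabooLaw κ z (j + n)).real {z}ᶜ := by
    obtain ⟨n', rfl⟩ := Nat.exists_eq_succ_of_ne_zero hn
    rw [Nat.succ_eq_add_one, ← add_assoc, tabooLaw_succ, measureReal_def, measureReal_def,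
      Measure.restrict_apply .univ, Measure.restrict_apply (measurableSet_singleton z).compl]
    simp
  have hle : (tabooLaw κ z (j + n)).real {z}ᶜ ≤ β.real {z}ᶜ :=
    ENNReal.toReal_mono (measure_ne_top _ _) (tabooLaw_add_le j n _)
  have hβ : β.real Set.univ = (tabooLaw κ z j).real Set.univ := by
    simp only [measureReal_def, β, iterate_bind_univ]
  have hz : ε * (tabooLaw κ z j).real Set.univ ≤ β.real {z} := by
    rw [← integral_indicator_one (measurableSet_singleton z), hint]
    have := integral_mono (μ := tabooLaw κ z j) (integrable_const ε)
      (integrable_of_bounds (measurable_iterate_transOp measurable_indicator_singleton n)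
        (iterate_transOp_mem_Icc measurable_indicator_singleton indicator_singleton_mem_Icc n))
      hD.2.2
    simpa [mul_comm] using this
  have hadd := measureReal_add_measureReal_compl (μ := β) (measurableSet_singleton z)
  linarith

lemma Doeblin.tabooLaw_summable (hD : Doeblin κ z n ε) (hn : n ≠ 0) :
    ∑' k, tabooLaw κ z k Set.univ ≠ ⊤ := by
  have hn' : 0 < n := Nat.pos_of_ne_zero hn
  have hmono : ∀ k, (tabooLaw κ z k).real Set.univ ≤ 1 := by
    intro k
    have := ENNReal.toReal_mono (by simp [iterate_bind_univ, tabooLaw])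
      (tabooLaw_add_le (κ := κ) (z := z) 0 k Set.univ)
    rw [zero_add] at this
    simpa [iterate_bind_univ, tabooLaw, measureReal_def] using this
  have hgeom : ∀ r q, (tabooLaw κ z (r + n * q)).real Set.univ ≤ (1 - ε) ^ q := by
    intro r q
    induction q with
    | zero => simpa using hmono r
    | succ q ih =>
      rw [mul_add, mul_one, ← add_assoc, pow_succ']
      exact (hD.tabooLaw_real_le hn _).trans
        (mul_le_mul_of_nonneg_left ih (sub_nonneg.2 hD.2.1))
  -- Times are split according to their residue modulo `n`.
  have hsum : Summable fun k => (tabooLaw κ z k).real Set.univ := by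
    have : NeZero n := ⟨hn⟩
    rw [← (Nat.divModEquiv n).symm.summable_iff, ← (Equiv.prodComm _ _).summable_iff]
    refine (summable_prod_of_nonneg fun _ => measureReal_nonneg).2 ⟨fun r => ?_,
      (hasSum_fintype _).summable⟩
    refine Summable.of_nonneg_of_le (fun _ => measureReal_nonneg) (fun q => ?_)
      (summable_geometric_of_lt_one (sub_nonneg.2 hD.2.1) (sub_lt_self 1 hD.1))
    have := hgeom r q
    simpa [Nat.divModEquiv, add_comm, mul_comm] using this
  have := hsum.tsum_ofReal_ne_top
  simpa [ofReal_measureReal] using this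

/-- The expected occupation measure of one excursion from the atom is finite and invariant; its
normalization is an invariant probability measure. -/
lemma Doeblin.exists_invariant (hD : Doeblin κ z n ε) (hn : n ≠ 0) :
    ∃ ν : Measure E, IsProbabilityMeasure ν ∧ ν.bind κ = ν := by
  set ρ : Measure E := Measure.sum (tabooLaw κ z) with hρ
  have hfin : ρ Set.univ ≠ ⊤ := by
    rw [hρ, Measure.sum_apply _ .univ]; exact hD.tabooLaw_summable hn
  have hbind : ρ.bind κ = Measure.sum fun k => (tabooLaw κ z k).bind κ := by
    ext s hs
    rw [Measure.bind_apply hs κ.aemeasurable, hρ, lintegral_sum_measure, Measure.sum_apply _ hs]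
    exact tsum_congr fun k => (Measure.bind_apply hs κ.aemeasurable).symm
  -- Each step splits into the part that stays away from the atom and the part that hits it.
  have hsplit : ∀ s, MeasurableSet s → ρ.bind κ s + Measure.dirac z s
      = ρ s + ρ.bind κ {z} * Measure.dirac z s := by
    intro s hs
    have hk : ∀ k, (tabooLaw κ z k).bind κ s
        = tabooLaw κ z (k + 1) s + (tabooLaw κ z k).bind κ {z} * Measure.dirac z s := by
      intro k
      rw [tabooLaw_succ, Measure.restrict_apply hs, Measure.dirac_apply' z hs,
        ← measure_inter_add_sdiff s (measurableSet_singleton z), add_comm]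
      congr 1
      by_cases h : z ∈ s
      · simp [h]
      · simp [h]
    rw [hbind, Measure.sum_apply _ hs, Measure.sum_apply _ (measurableSet_singleton z),
      tsum_congr hk, ENNReal.tsum_add, ENNReal.tsum_mul_right, hρ, Measure.sum_apply _ hs,
      tsum_eq_zero_add' (f := fun k => tabooLaw κ z k s) ENNReal.summable]
    simp only [tabooLaw, Function.iterate_zero, id]
    ring
  have hone : ρ.bind κ {z} = 1 := by
    have h := hsplit Set.univ .univ
    have hu : ρ.bind κ Set.univ = ρ Set.univ := iterate_bind_univ (κ := κ) ρ 1
    rw [hu] at h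
    simpa using ((ENNReal.add_right_inj hfin).1 h).symm
  have hinv : ρ.bind κ = ρ := by
    ext s hs
    have h := hsplit s hs
    rw [hone, one_mul] at h
    exact (ENNReal.add_left_inj (measure_ne_top _ _)).1 h
  have hpos : ρ Set.univ ≠ 0 := by
    intro h0
    rw [Measure.measure_univ_eq_zero] at h0
    rw [hinv, h0] at hone
    simp at hone
  refine ⟨(ρ Set.univ)⁻¹ • ρ, ⟨?_⟩, ?_⟩
  · simp [ENNReal.inv_mul_cancel hpos hfin]
  · ext s hs
    rw [Measure.bind_apply hs κ.aemeasurable, lintegral_smul_measure,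
      ← Measure.bind_apply hs κ.aemeasurable, hinv]
    rfl

end Doeblin

/-! ### The transition kernel of the model -/

section Kernel

open ProbabilityTheory

variable {N : ℕ} (M : Model N)

instance : IsProbabilityMeasure M.lawV := M.prob_V
instance (i : Fin N) : IsProbabilityMeasure (M.lawS i) := M.prob_S i
instance (j : Fin N) : IsProbabilityMeasure (M.lawA j) := M.prob_A j

/-- The joint law of `(V n, S n, A (n+1))` given `Z n = i` and `Z (n+1) = j`. -/
noncomputable def Model.incr (i j : Fin N) : Measure (ℝ × ℝ × ℝ) :=
  M.lawV.prod ((M.lawS i).prod (M.lawA j))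

instance (i j : Fin N) : IsProbabilityMeasure (M.incr i j) := by
  unfold Model.incr; infer_instance

lemma Model.P_nonneg (i j : Fin N) : 0 ≤ M.P i j :=
  Matrix.nonneg_of_mem_rowStochastic M.stochastic

lemma Model.sum_P (i : Fin N) : ∑ j, M.P i j = 1 :=
  Matrix.sum_row_of_mem_rowStochastic M.stochastic i

lemma measurable_next (j : Fin N) : Measurable fun q : ℝ × ℝ × ℝ × ℝ =>
    ((max (q.2.1 * q.1 + q.2.2.1 - q.2.2.2) 0, j) : ℝ × Fin N) := by
  fun_prop

lemma measurable_next_right (w : ℝ) (j : Fin N) : Measurable fun u : ℝ × ℝ × ℝ =>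
    ((max (u.1 * w + u.2.1 - u.2.2) 0, j) : ℝ × Fin N) := by
  fun_prop

lemma Model.step_apply (x : ℝ × Fin N) {B : Set (ℝ × Fin N)} (hB : MeasurableSet B) :
    M.step x B = ∑ j, ENNReal.ofReal (M.P x.2 j) *
      M.incr x.2 j {u | (max (u.1 * x.1 + u.2.1 - u.2.2) 0, j) ∈ B} := by
  simp only [Model.step, Measure.finsetSum_apply, Measure.smul_apply, smul_eq_mul]
  refine Finset.sum_congr rfl fun j _ => ?_
  rw [Measure.map_apply (measurable_next_right x.1 j) hB]
  rfl

lemma Model.measurable_step : Measurable M.step := by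
  refine measurable_from_prod_countable_left fun i => ?_
  refine Measure.measurable_of_measurable_coe _ fun B hB => ?_
  simp only [M.step_apply _ hB]
  refine Finset.measurable_sum _ fun j _ => Measurable.const_mul ?_ _
  exact measurable_measure_prodMk_left (ν := M.incr i j) (measurable_next j hB)

/-- The transition kernel of the Markov chain `(W n, Z n)`. -/
noncomputable def Model.kernel : Kernel (ℝ × Fin N) (ℝ × Fin N) := ⟨M.step, M.measurable_step⟩

lemma Model.kernel_apply (x : ℝ × Fin N) : M.kernel x = M.step x := rfl

instance : IsMarkovKernel M.kernel := by
  refine ⟨fun x => ⟨?_⟩⟩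
  rw [M.kernel_apply, M.step_apply x .univ]
  simp [← ENNReal.ofReal_sum_of_nonneg fun j _ => M.P_nonneg x.2 j, M.sum_P]

instance (x : ℝ × Fin N) : IsProbabilityMeasure (M.step x) :=
  inferInstanceAs (IsProbabilityMeasure (M.kernel x))

lemma Model.integral_step {G : Type*} [NormedAddCommGroup G] [NormedSpace ℝ G]
    {f : ℝ × Fin N → G} (hf : StronglyMeasurable f) {C : ℝ} (hC : ∀ x, ‖f x‖ ≤ C)
    (x : ℝ × Fin N) : ∫ y, f y ∂M.step x
      = ∑ j, M.P x.2 j • ∫ u, f (max (u.1 * x.1 + u.2.1 - u.2.2) 0, j) ∂M.incr x.2 j := by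
  rw [Model.step, integral_finsetSum_measure]
  · refine Finset.sum_congr rfl fun j _ => ?_
    rw [integral_smul_measure, ENNReal.toReal_ofReal (M.P_nonneg _ _),
      integral_map (measurable_next_right x.1 j).aemeasurable hf.aestronglyMeasurable]
    rfl
  · intro j _
    have : IsProbabilityMeasure (Measure.map (fun u : ℝ × ℝ × ℝ =>
        ((max (u.1 * x.1 + u.2.1 - u.2.2) 0, j) : ℝ × Fin N)) (M.incr x.2 j)) :=
      Measure.isProbabilityMeasure_map (measurable_next_right x.1 j).aemeasurable
    exact Integrable.smul_measure (Integrable.of_bound hf.aestronglyMeasurable C (.of_forall hC))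
      ENNReal.ofReal_ne_top

lemma Model.isStationaryLaw_iff (ν : Measure (ℝ × Fin N)) :
    M.IsStationaryLaw ν ↔ IsProbabilityMeasure ν ∧ ν.bind M.kernel = ν := by
  refine and_congr_right fun _ => ⟨fun h => ?_, fun h B hB => ?_⟩
  · ext B hB
    rw [Measure.bind_apply hB M.kernel.aemeasurable, h B hB]
    rfl
  · conv_lhs => rw [← h, Measure.bind_apply hB M.kernel.aemeasurable]
    rfl

lemma measurableSet_neg : MeasurableSet {x : ℝ × Fin N | x.1 < 0} :=
  measurableSet_lt measurable_fst measurable_const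

lemma Model.ae_nonneg_step (x : ℝ × Fin N) : ∀ᵐ y ∂M.step x, 0 ≤ y.1 := by
  have h := M.step_apply x (measurableSet_neg (N := N))
  simp only [ae_iff, not_le, h]
  simp

lemma Model.ae_nonneg_of_invariant {ν : Measure (ℝ × Fin N)} (hν : ν.bind M.kernel = ν) :
    ∀ᵐ x ∂ν, 0 ≤ x.1 := by
  simp only [ae_iff, not_le]
  rw [← hν, Measure.bind_apply measurableSet_neg M.kernel.aemeasurable, lintegral_eq_zero_iff
    (M.kernel.measurable_coe measurableSet_neg)]
  refine .of_forall fun x => ?_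
  simpa [ae_iff, Model.kernel_apply] using M.ae_nonneg_step x

lemma bounded_of_fintype (h : Fin N → ℝ) : ∃ C, ∀ i, |h i| ≤ C :=
  ⟨∑ i, |h i|, fun i =>
    Finset.single_le_sum (f := fun i => |h i|) (fun _ _ => abs_nonneg _) (Finset.mem_univ i)⟩

lemma measurable_state (h : Fin N → ℝ) : Measurable fun x : ℝ × Fin N => h x.2 :=
  (measurable_of_finite h).comp measurable_snd

/-- The truncation of a function of the background state to nonnegative levels. -/
noncomputable def posLevel (h : Fin N → ℝ) (x : ℝ × Fin N) : ℝ := if 0 ≤ x.1 then h x.2 else 0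

lemma measurable_posLevel (h : Fin N → ℝ) : Measurable (posLevel h) :=
  Measurable.ite (measurableSet_le measurable_const measurable_fst) (measurable_state h)
    measurable_const

lemma posLevel_mem_Icc {h : Fin N → ℝ} (h0 : ∀ i, h i ∈ Set.Icc (0 : ℝ) 1) (x : ℝ × Fin N) :
    posLevel h x ∈ Set.Icc (0 : ℝ) 1 := by
  unfold posLevel
  split_ifs
  exacts [h0 _, ⟨le_rfl, zero_le_one⟩]

lemma Model.transOp_state (h : Fin N → ℝ) :
    transOp M.kernel (fun x => h x.2) = fun x => (M.P.mulVec h) x.2 := by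
  obtain ⟨C, hC⟩ := bounded_of_fintype h
  funext x
  rw [transOp, Model.kernel_apply, M.integral_step (measurable_state h).stronglyMeasurable
    (fun x => hC x.2)]
  simp [Matrix.mulVec, dotProduct]

lemma Model.iterate_transOp_state (h : Fin N → ℝ) (k : ℕ) :
    (transOp M.kernel)^[k] (fun x => h x.2) = fun x => ((M.P ^ k).mulVec h) x.2 := by
  induction k with
  | zero => simp
  | succ k ih =>
    rw [Function.iterate_succ_apply', ih, M.transOp_state, pow_succ', Matrix.mulVec_mulVec]

lemma Model.transOp_posLevel (h : Fin N → ℝ) :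
    transOp M.kernel (posLevel h) = fun x => (M.P.mulVec h) x.2 := by
  rw [← M.transOp_state]
  funext x
  refine integral_congr_ae ?_
  filter_upwards [M.ae_nonneg_step x] with y hy using if_pos hy

/-- If `V < 0`, `S < A` and the present level is nonnegative, the next level is `0`. -/
lemma Model.posLevel_le_transOp (hV : ∀ᵐ v ∂M.lawV, v < 0) (i l : Fin N) (x : ℝ × Fin N) :
    (M.P i l * ((M.lawS i).prod (M.lawA l)).real {y : ℝ × ℝ | y.1 < y.2})
      * posLevel (Pi.single i 1) x
      ≤ transOp M.kernel (Set.indicator {((0 : ℝ), l)} 1) x := by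
  have h0 := (transOp_mem_Icc (κ := M.kernel) (measurable_indicator_singleton (z := ((0 : ℝ), l)))
    indicator_singleton_mem_Icc x).1
  by_cases hx : 0 ≤ x.1 ∧ x.2 = i
  swap
  · have : posLevel (Pi.single i 1) x = 0 := by
      unfold posLevel
      split_ifs with h
      · exact Pi.single_eq_of_ne (fun h' => hx ⟨h, h'⟩) 1
      · rfl
    rwa [this, mul_zero]
  obtain ⟨w, _⟩ := x
  obtain ⟨hw, rfl⟩ := hx
  simp only at hw ⊢
  rename_i i
  rw [posLevel, if_pos hw, Pi.single_eq_same, mul_one, transOp,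
    integral_indicator_one (measurableSet_singleton _), measureReal_def, measureReal_def,
    Model.kernel_apply, M.step_apply _ (measurableSet_singleton _), ← ENNReal.toReal_ofReal
    (M.P_nonneg i l), ← ENNReal.toReal_mul]
  refine ENNReal.toReal_mono ?_ ?_
  · exact ENNReal.sum_ne_top.2 fun j _ => ENNReal.mul_ne_top ENNReal.ofReal_ne_top
      (measure_ne_top _ _)
  · refine le_trans ?_ (Finset.single_le_sum (fun _ _ => zero_le) (Finset.mem_univ l))
    refine mul_le_mul_right ?_ _
    have hV' : M.lawV (Set.Iio 0) = 1 := by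
      rw [← prob_compl_eq_zero_iff measurableSet_Iio]
      exact hV
    calc (M.lawS i).prod (M.lawA l) {y : ℝ × ℝ | y.1 < y.2}
        = M.incr i l (Set.Iio 0 ×ˢ {y : ℝ × ℝ | y.1 < y.2}) := by
          rw [Model.incr, Measure.prod_prod, hV', one_mul]
      _ ≤ _ := by
          refine measure_mono fun u hu => ?_
          have h1 : u.1 * w ≤ 0 := mul_nonpos_of_nonpos_of_nonneg (le_of_lt hu.1) hw
          have h2 : u.2.1 < u.2.2 := hu.2
          simp only [Set.mem_ofPred_eq, Set.mem_singleton_iff, Prod.mk.injEq, and_true]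
          exact max_eq_right (by linarith)

/-- The chain `(W n, Z n)` satisfies the Doeblin condition with an atom `(0, l)`: after sufficiently
many steps the background chain is in the state `i` with probability bounded away from `0`, and
from there the level drops to `0` with positive probability. -/
lemma Model.exists_doeblin (hirr : M.P.IsIrreducible) (haper : Aperiodic M.P)
    (hV : ∀ᵐ v ∂M.lawV, v < 0)
    (hstable : ∃ i l : Fin N, 0 < M.P i l ∧
      0 < ((M.lawS i).prod (M.lawA l)) {x : ℝ × ℝ | x.1 < x.2}) :
    ∃ (z : ℝ × Fin N) (n : ℕ) (ε : ℝ), n ≠ 0 ∧ Doeblin M.kernel z n ε := by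
  obtain ⟨i, l, hP, hSA⟩ := hstable
  obtain ⟨k, hk, hk1⟩ := ((eventually_pow_pos hirr haper).and (eventually_ge_atTop 1)).exists
  obtain ⟨k, rfl⟩ := Nat.exists_eq_add_of_le' hk1
  obtain ⟨i₀, -, hi₀⟩ := Finset.exists_min_image Finset.univ (fun a => (M.P ^ (k + 1)) a i)
    ⟨i, Finset.mem_univ i⟩
  set δ := M.P i l * ((M.lawS i).prod (M.lawA l)).real {y : ℝ × ℝ | y.1 < y.2} with hδ
  have hδ0 : 0 < δ := mul_pos hP (ENNReal.toReal_pos hSA.ne' (measure_ne_top _ _))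
  set z : ℝ × Fin N := (0, l)
  set ψ : ℝ × Fin N → ℝ := posLevel (Pi.single i 1)
  have hψ : ∀ x, ψ x ∈ Set.Icc (0 : ℝ) 1 := posLevel_mem_Icc fun a => by
    by_cases h : a = i
    · subst h; simp
    · simp [h]
  have hz := measurable_indicator_singleton (z := z)
  have hle : ∀ x, δ * (M.P ^ (k + 1)) i₀ i
      ≤ (transOp M.kernel)^[k + 1 + 1] (Set.indicator {z} 1) x := by
    intro x
    have h1 := iterate_transOp_mono (κ := M.kernel) (g := fun x => δ * ψ x + 0)
      (((measurable_posLevel _).const_mul δ).add_const 0) (measurable_transOp hz)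
      (a := 0) (b := δ)
      (fun x => ⟨by simpa using mul_nonneg hδ0.le (hψ x).1, by
        simpa using mul_le_of_le_one_right hδ0.le (hψ x).2⟩)
      (transOp_mem_Icc hz indicator_singleton_mem_Icc)
      (fun x => by simpa using M.posLevel_le_transOp hV i l x) (k + 1) x
    rw [iterate_transOp_affine (measurable_posLevel _) hψ, Function.iterate_succ_apply,
      M.transOp_posLevel, M.iterate_transOp_state] at h1
    rw [Matrix.mulVec_mulVec, ← pow_succ, Matrix.mulVec_single_one] at h1
    simp only [add_zero] at h1
    exact (mul_le_mul_of_nonneg_left (hi₀ x.2 (Finset.mem_univ _)) hδ0.le).trans h1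
  refine ⟨z, k + 1 + 1, δ * (M.P ^ (k + 1)) i₀ i, by omega, mul_pos hδ0 (hk _ _), ?_, hle⟩
  exact (hle z).trans (iterate_transOp_mem_Icc hz indicator_singleton_mem_Icc _ z).2

end Kernel

/-! ### The law of the recursion -/

section Recursion

lemma past_mono {Ω : Type*} {N : ℕ} {W : ℕ → Ω → ℝ} {Z : ℕ → Ω → Fin N} {V S A : ℕ → Ω → ℝ}
    {n k : ℕ} (h : n ≤ k) : past W Z V S A n ≤ past W Z V S A k := by
  refine sup_le_sup (sup_le_sup le_rfl ?_) ?_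
  · exact iSup₂_mono' fun r hr => ⟨r, hr.trans h, le_rfl⟩
  · exact iSup₂_mono' fun r hr => ⟨r, hr.trans_le h, le_rfl⟩

lemma measurable_past_incr {Ω : Type*} {N : ℕ} {W : ℕ → Ω → ℝ} {Z : ℕ → Ω → Fin N}
    {V S A : ℕ → Ω → ℝ} {n k : ℕ} (h : n < k) :
    Measurable[past W Z V S A k] fun ω => (V n ω, S n ω, A (n + 1) ω) := by
  refine Measurable.mono (comap_measurable _) ?_ le_rfl
  exact le_sup_of_le_right (le_iSup₂_of_le n h le_rfl)

variable {Ω : Type*} [MeasurableSpace Ω] {N : ℕ} {M : Model N} {μ : Measure Ω}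
  {W : ℕ → Ω → ℝ} {Z : ℕ → Ω → Fin N} {V S A : ℕ → Ω → ℝ}

/-- The level at time `n` is a function of the past before step `n`. -/
lemma IsProcess.measurable_past (h : IsProcess M μ W Z V S A) (n : ℕ) :
    Measurable[past W Z V S A n] (W n) := by
  induction n with
  | zero =>
    refine Measurable.mono (comap_measurable _) ?_ le_rfl
    exact le_sup_of_le_left (le_sup_of_le_left le_rfl)
  | succ n ih =>
    have hu := measurable_past_incr (W := W) (Z := Z) (V := V) (S := S) (A := A)
      (Nat.lt_succ_self n)
    have hW := Measurable.mono ih (past_mono (W := W) (Z := Z) (V := V) (S := S) (A := A)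
      (Nat.le_succ n)) le_rfl
    have hg : Measurable fun q : ℝ × ℝ × ℝ × ℝ => max (q.2.1 * q.1 + q.2.2.1 - q.2.2.2) 0 := by
      fun_prop
    have := hg.comp (hW.prodMk hu)
    refine (funext fun ω => h.recursion n ω : W (n + 1) = _) ▸ this

/-- On the event `Z n = i`, `Z (n+1) = j`, the level `W n` is independent of the increment
`(V n, S n, A (n+1))`, which has the law `M.incr i j`. -/
lemma IsProcess.map_restrict [IsProbabilityMeasure μ] (h : IsProcess M μ W Z V S A) (n : ℕ)
    (i j : Fin N) :
    (μ.restrict {ω | Z n ω = i ∧ Z (n + 1) ω = j}).map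
        (fun ω => (W n ω, V n ω, S n ω, A (n + 1) ω))
      = ENNReal.ofReal (M.P i j) • ((μ.restrict {ω | Z n ω = i}).map (W n)).prod (M.incr i j) := by
  have hmU : Measurable fun ω => (V n ω, S n ω, A (n + 1) ω) :=
    (h.measurable_V n).prodMk ((h.measurable_S n).prodMk (h.measurable_A (n + 1)))
  have hi : MeasurableSet {ω | Z n ω = i} := h.measurable_Z n (measurableSet_singleton i)
  have hj : MeasurableSet {ω | Z (n + 1) ω = j} :=
    h.measurable_Z (n + 1) (measurableSet_singleton j)
  have key : ∀ B : Set ℝ, MeasurableSet B →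
      (μ.restrict (W n ⁻¹' B ∩ {ω | Z n ω = i ∧ Z (n + 1) ω = j})).map
        (fun ω => (V n ω, S n ω, A (n + 1) ω))
      = (μ (W n ⁻¹' B ∩ {ω | Z n ω = i}) * ENNReal.ofReal (M.P i j)) • M.incr i j := by
    intro B hB
    refine Measure.ext_prod₃ fun {s t u} hs ht hu => ?_
    rw [Measure.map_apply hmU (hs.prod (ht.prod hu)),
      Measure.restrict_apply (hmU (hs.prod (ht.prod hu))), Measure.smul_apply, Model.incr,
      Measure.prod_prod, Measure.prod_prod, smul_eq_mul]
    have := h.step_law n i j (W n ⁻¹' B) s t u (h.measurable_past n hB) hs ht hu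
    calc _ = μ (W n ⁻¹' B ∩ {ω | Z n ω = i ∧ V n ω ∈ s ∧ S n ω ∈ t ∧ Z (n + 1) ω = j
              ∧ A (n + 1) ω ∈ u}) := by
            congr 1
            ext ω
            simp only [Set.mem_inter_iff, Set.mem_preimage, Set.mem_prod, Set.mem_ofPred_eq]
            tauto
      _ = _ := by rw [this]; ring
  refine Measure.ext_prod fun {B C} hB hC => ?_
  have hm := (h.measurable_W n).prodMk hmU
  rw [Measure.map_apply hm (hB.prod hC), Measure.restrict_apply (hm (hB.prod hC)),
    Measure.smul_apply, Measure.prod_prod, Measure.map_apply (h.measurable_W n) hB,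
    Measure.restrict_apply (h.measurable_W n hB)]
  have := congrArg (fun ρ => ρ C) (key B hB)
  simp only [Measure.smul_apply, smul_eq_mul] at this
  rw [Measure.map_apply hmU hC, Measure.restrict_apply (hmU hC)] at this
  rw [smul_eq_mul, ← mul_assoc, mul_comm (ENNReal.ofReal _), ← this]
  congr 1
  ext ω
  simp only [Set.mem_inter_iff, Set.mem_preimage, Set.mem_prod, Set.mem_ofPred_eq]
  tauto

/-- The law of `(W n, Z n)`. -/
noncomputable def chainLaw (μ : Measure Ω) (W : ℕ → Ω → ℝ) (Z : ℕ → Ω → Fin N) (n : ℕ) :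
    Measure (ℝ × Fin N) :=
  μ.map fun ω => (W n ω, Z n ω)

lemma IsProcess.measurable_pair (h : IsProcess M μ W Z V S A) (n : ℕ) :
    Measurable fun ω => (W n ω, Z n ω) :=
  (h.measurable_W n).prodMk (h.measurable_Z n)

lemma sum_restrict_state {X : Type*} [MeasurableSpace X] {Y : X → Fin N} (hY : Measurable Y)
    (ρ : Measure X) : ∑ i, ρ.restrict {x | Y x = i} = ρ := by
  rw [← Measure.sum_fintype, ← Measure.restrict_iUnion]
  · have : ⋃ i, {x | Y x = i} = Set.univ := by ext x; simp
    rw [this, Measure.restrict_univ]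
  · intro i j hij
    exact Set.disjoint_left.2 fun x (hx : Y x = i) (hx' : Y x = j) => hij (hx.symm.trans hx')
  · exact fun i => hY (measurableSet_singleton i)

/-- The laws of `(W n, Z n)` evolve according to the transition kernel. -/
lemma IsProcess.chainLaw_succ [IsProbabilityMeasure μ] (h : IsProcess M μ W Z V S A) (n : ℕ) :
    chainLaw μ W Z (n + 1) = (chainLaw μ W Z n).bind M.kernel := by
  ext B hB
  have hi : ∀ i, MeasurableSet {ω | Z n ω = i} := fun i =>
    h.measurable_Z n (measurableSet_singleton i)
  have hj : ∀ j, MeasurableSet {ω | Z (n + 1) ω = j} := fun j =>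
    h.measurable_Z (n + 1) (measurableSet_singleton j)
  have hm : Measurable fun ω => (W n ω, V n ω, S n ω, A (n + 1) ω) :=
    (h.measurable_W n).prodMk
      ((h.measurable_V n).prodMk ((h.measurable_S n).prodMk (h.measurable_A (n + 1))))
  rw [chainLaw, Measure.map_apply (h.measurable_pair _) hB,
    Measure.bind_apply hB M.kernel.aemeasurable, chainLaw,
    lintegral_map (M.kernel.measurable_coe hB) (h.measurable_pair n),
    ← sum_restrict_state (h.measurable_Z n) μ, lintegral_finsetSum_measure,
    Measure.finsetSum_apply]
  refine Finset.sum_congr rfl fun i _ => ?_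
  calc μ.restrict {ω | Z n ω = i} ((fun ω => (W (n + 1) ω, Z (n + 1) ω)) ⁻¹' B)
      = ∑ j, ((μ.restrict {ω | Z n ω = i ∧ Z (n + 1) ω = j}).map
          (fun ω => (W n ω, V n ω, S n ω, A (n + 1) ω)))
          {q | (max (q.2.1 * q.1 + q.2.2.1 - q.2.2.2) 0, j) ∈ B} := by
        conv_lhs => rw [← sum_restrict_state (h.measurable_Z (n + 1)) (μ.restrict {ω | Z n ω = i}),
          Measure.finsetSum_apply]
        refine Finset.sum_congr rfl fun j _ => ?_
        have hB' : MeasurableSet {q : ℝ × ℝ × ℝ × ℝ |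
            (max (q.2.1 * q.1 + q.2.2.1 - q.2.2.2) 0, j) ∈ B} := measurable_next j hB
        have hset : {ω | Z (n + 1) ω = j} ∩ {ω | Z n ω = i}
            = {ω | Z n ω = i ∧ Z (n + 1) ω = j} := by ext ω; exact and_comm
        have hmeas : MeasurableSet {ω | Z n ω = i ∧ Z (n + 1) ω = j} := (hi i).inter (hj j)
        rw [Measure.restrict_restrict (hj j), hset, Measure.map_apply hm hB',
          Measure.restrict_apply' hmeas, Measure.restrict_apply' hmeas]
        congr 1
        ext ω
        simp only [Set.mem_inter_iff, Set.mem_preimage, Set.mem_ofPred_eq, h.recursion n ω]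
        refine and_congr_left fun hω => ?_
        rw [hω.2]
    _ = ∑ j, ∫⁻ ω in {ω | Z n ω = i}, ENNReal.ofReal (M.P i j) *
          M.incr i j {u | (max (u.1 * W n ω + u.2.1 - u.2.2) 0, j) ∈ B} ∂μ := by
        refine Finset.sum_congr rfl fun j _ => ?_
        have hB' : MeasurableSet {q : ℝ × ℝ × ℝ × ℝ |
            (max (q.2.1 * q.1 + q.2.2.1 - q.2.2.2) 0, j) ∈ B} := measurable_next j hB
        have hsec := measurable_measure_prodMk_left (ν := M.incr i j) hB'
        rw [h.map_restrict n i j, Measure.smul_apply, Measure.prod_apply hB',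
          lintegral_map hsec (h.measurable_W n), smul_eq_mul]
        exact (lintegral_const_mul _ (hsec.comp (h.measurable_W n))).symm
    _ = ∫⁻ ω in {ω | Z n ω = i}, M.kernel (W n ω, Z n ω) B ∂μ := by
        rw [← lintegral_finsetSum]
        · refine setLIntegral_congr_fun (hi i) fun ω (hω : Z n ω = i) => ?_
          simp only [Model.kernel_apply, M.step_apply _ hB, hω]
        · intro j _
          exact ((measurable_measure_prodMk_left (ν := M.incr i j) (measurable_next j hB)).comp
            (h.measurable_W n)).const_mul _

lemma IsProcess.chainLaw_eq_iterate [IsProbabilityMeasure μ] (h : IsProcess M μ W Z V S A)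
    (n : ℕ) : chainLaw μ W Z n
      = (fun β : Measure (ℝ × Fin N) => β.bind M.kernel)^[n] (chainLaw μ W Z 0) := by
  induction n with
  | zero => rfl
  | succ n ih => rw [h.chainLaw_succ, ih, Function.iterate_succ_apply']

end Recursion

/-! ### Gluing holomorphic functions along the imaginary axis -/

section Gluing

open Complex

/-- A continuous function that is holomorphic off the imaginary axis is entire: a rectangle that
meets the axis is split into two rectangles whose interiors do not, so Morera's theorem applies. -/
lemma differentiable_of_differentiableOn_re_ne_zero {f : ℂ → ℂ} (hf : Continuous f)
    (hd : DifferentiableOn ℂ f {z | z.re ≠ 0}) : Differentiable ℂ f := by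
  rw [← differentiableOn_univ, ← isConservativeOn_and_continuousOn_iff_isDifferentiableOn
    isOpen_univ]
  refine ⟨fun z w _ => ?_, hf.continuousOn⟩
  rw [← add_eq_zero_iff_eq_neg, wedgeIntegral_add_wedgeIntegral_eq]
  have hhalf : ∀ a b : ℂ, 0 ∉ Set.Ioo (min a.re b.re) (max a.re b.re) →
      (∫ x : ℝ in a.re..b.re, f (x + a.im * I)) - (∫ x : ℝ in a.re..b.re, f (x + b.im * I)) +
      I • (∫ y : ℝ in a.im..b.im, f (b.re + y * I)) -
      I • (∫ y : ℝ in a.im..b.im, f (a.re + y * I)) = 0 := fun a b h =>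
    integral_boundary_rect_eq_zero_of_continuousOn_of_differentiableOn f a b hf.continuousOn
      (hd.mono fun x hx h0 => h (h0 ▸ hx.1))
  have h₁ := hhalf z ⟨0, w.im⟩ (by rcases le_total z.re 0 with h | h <;> simp [h])
  have h₂ := hhalf ⟨0, z.im⟩ w (by rcases le_total w.re 0 with h | h <;> simp [h])
  have hi : ∀ (c a b : ℝ), IntervalIntegrable (fun x : ℝ => f (x + c * I)) volume a b :=
    fun c a b => (by fun_prop : Continuous fun x : ℝ => f (x + c * I)).intervalIntegrable a b
  rw [← intervalIntegral.integral_add_adjacent_intervals (hi z.im z.re 0) (hi z.im 0 w.re),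
    ← intervalIntegral.integral_add_adjacent_intervals (hi w.im z.re 0) (hi w.im 0 w.re)]
  linear_combination h₁ + h₂

/-- Polynomial growth of a function on a set. -/
def PolyGrowthOn (f : ℂ → ℂ) (U : Set ℂ) : Prop :=
  ∃ (C : ℝ) (n : ℕ), 0 ≤ C ∧ ∀ z ∈ U, ‖f z‖ ≤ C * (1 + ‖z‖) ^ n

variable {f g : ℂ → ℂ} {U : Set ℂ}

lemma PolyGrowthOn.of_bound {C : ℝ} (h : ∀ z ∈ U, ‖f z‖ ≤ C) : PolyGrowthOn f U :=
  ⟨max C 0, 0, le_max_right _ _, fun z hz => by simpa using Or.inl (h z hz)⟩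

lemma PolyGrowthOn.mul (hf : PolyGrowthOn f U) (hg : PolyGrowthOn g U) :
    PolyGrowthOn (fun z => f z * g z) U := by
  obtain ⟨C, n, hC, hf⟩ := hf
  obtain ⟨C', n', hC', hg⟩ := hg
  refine ⟨C * C', n + n', mul_nonneg hC hC', fun z hz => ?_⟩
  calc ‖f z * g z‖ = ‖f z‖ * ‖g z‖ := norm_mul _ _
    _ ≤ (C * (1 + ‖z‖) ^ n) * (C' * (1 + ‖z‖) ^ n') :=
      mul_le_mul (hf z hz) (hg z hz) (norm_nonneg _) (by positivity)
    _ = C * C' * (1 + ‖z‖) ^ (n + n') := by ring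

lemma PolyGrowthOn.add (hf : PolyGrowthOn f U) (hg : PolyGrowthOn g U) :
    PolyGrowthOn (fun z => f z + g z) U := by
  obtain ⟨C, n, hC, hf⟩ := hf
  obtain ⟨C', n', hC', hg⟩ := hg
  refine ⟨C + C', max n n', add_nonneg hC hC', fun z hz => ?_⟩
  have h1 : 1 ≤ 1 + ‖z‖ := le_add_of_nonneg_right (norm_nonneg z)
  calc ‖f z + g z‖ ≤ C * (1 + ‖z‖) ^ n + C' * (1 + ‖z‖) ^ n' :=
      norm_add_le_of_le (hf z hz) (hg z hz)
    _ ≤ C * (1 + ‖z‖) ^ max n n' + C' * (1 + ‖z‖) ^ max n n' := by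
      gcongr
      exacts [le_max_left _ _, le_max_right _ _]
    _ = (C + C') * (1 + ‖z‖) ^ max n n' := by ring

lemma PolyGrowthOn.finsetSum {ι : Type*} {F : ι → ℂ → ℂ} (s : Finset ι)
    (h : ∀ i ∈ s, PolyGrowthOn (F i) U) : PolyGrowthOn (fun z => ∑ i ∈ s, F i z) U := by
  classical
  induction s using Finset.induction_on with
  | empty => exact .of_bound (C := 0) fun z _ => by simp
  | insert a s ha ih =>
    simp only [Finset.sum_insert ha]
    exact (h a (Finset.mem_insert_self a s)).add
      (ih fun i hi => h i (Finset.mem_insert_of_mem hi))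

lemma polyGrowthOn_eval (q : Polynomial ℂ) : PolyGrowthOn (fun z => q.eval z) U := by
  simp only [Polynomial.eval_eq_sum_range]
  refine .finsetSum _ fun i _ => .mul (.of_bound (C := ‖q.coeff i‖) fun _ _ => le_rfl)
    ⟨1, i, zero_le_one, fun z _ => ?_⟩
  rw [norm_pow, one_mul]
  gcongr
  linarith

/-- **Liouville's theorem** for functions of polynomial growth. -/
lemma exists_polynomial_of_polyGrowthOn (hf : Differentiable ℂ f)
    (hg : PolyGrowthOn f Set.univ) : ∃ q : Polynomial ℂ, ∀ z, f z = q.eval z := by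
  obtain ⟨C, n, hC, hg⟩ := hg
  have hzero : ∀ k, n < k → iteratedDeriv k f 0 = 0 := by
    intro k hk
    have hle : ∀ R : ℝ, 1 < R → ‖iteratedDeriv k f 0‖ ≤ k.factorial * C * 2 ^ n * R⁻¹ := by
      intro R hR
      have hR0 : 0 < R := zero_lt_one.trans hR
      have h := norm_iteratedDeriv_le_of_forall_mem_sphere_norm_le k hR0 hf.diffContOnCl
        (c := 0) (C := C * (2 * R) ^ n) fun z hz => (hg z trivial).trans (by
          rw [mem_sphere_zero_iff_norm.1 hz]
          gcongr
          linarith)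
      refine h.trans ?_
      obtain ⟨d, rfl⟩ := Nat.exists_eq_add_of_lt hk
      rw [mul_pow, div_le_iff₀ (by positivity)]
      have : (R : ℝ)⁻¹ * R ^ (n + d + 1) = R ^ n * R ^ d := by
        field_simp; ring
      calc ((n + d + 1).factorial : ℝ) * (C * (2 ^ n * R ^ n))
          = (n + d + 1).factorial * C * 2 ^ n * (R ^ n * 1) := by ring
        _ ≤ (n + d + 1).factorial * C * 2 ^ n * (R ^ n * R ^ d) := by
          gcongr
          exact one_le_pow₀ hR.le
        _ = _ := by rw [← this]; ring
    have hlim : Tendsto (fun R : ℝ => (k.factorial * C * 2 ^ n : ℝ) * R⁻¹) atTop (𝓝 0) := by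
      simpa using tendsto_inv_atTop_zero.const_mul (k.factorial * C * 2 ^ n : ℝ)
    exact norm_le_zero_iff.1 (ge_of_tendsto hlim ((eventually_gt_atTop 1).mono hle))
  refine ⟨∑ k ∈ Finset.range (n + 1),
    Polynomial.C ((k.factorial : ℂ)⁻¹ * iteratedDeriv k f 0) * Polynomial.X ^ k, fun z => ?_⟩
  rw [← taylorSeries_eq_of_entire' 0 z hf, tsum_eq_sum (s := Finset.range (n + 1))]
  · simp [Polynomial.eval_finsetSum]
  · intro k hk
    rw [hzero k (by simpa using hk)]
    simp

lemma tendsto_eval_div_pow_natDegree (q : Polynomial ℂ) :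
    Tendsto (fun x : ℝ => q.eval (x : ℂ) / (x : ℂ) ^ q.natDegree) atTop (𝓝 q.leadingCoeff) := by
  have hinv : Tendsto (fun x : ℝ => ((x : ℂ))⁻¹) atTop (𝓝 0) := by
    have := (Complex.continuous_ofReal.tendsto 0).comp tendsto_inv_atTop_zero
    simpa [Function.comp_def] using this
  have h := (q.reverse.continuous.tendsto 0).comp hinv
  rw [← Polynomial.coeff_zero_eq_eval_zero, Polynomial.coeff_zero_reverse] at h
  refine h.congr' ?_
  filter_upwards [eventually_gt_atTop 0] with x hx
  have hx' : (x : ℂ) ≠ 0 := Complex.ofReal_ne_zero.2 hx.ne'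
  let _ : Invertible (x : ℂ) := invertibleOfNonzero hx'
  have := Polynomial.eval₂_reverse_mul_pow (RingHom.id ℂ) (x : ℂ) q
  rw [eq_div_iff (pow_ne_zero _ hx')]
  simpa [Polynomial.eval₂_id] using this

/-- On the positive real axis a polynomial of larger degree dominates one of smaller degree. -/
lemma natDegree_le_of_norm_eval_le {q D : Polynomial ℂ} {C : ℝ}
    (h : ∀ x : ℝ, 0 ≤ x → ‖q.eval (x : ℂ)‖ ≤ C * ‖D.eval (x : ℂ)‖) :
    q.natDegree ≤ D.natDegree := by
  by_contra! hlt
  have hlim : Tendsto (fun x : ℝ => C * ‖D.eval (x : ℂ) / (x : ℂ) ^ D.natDegree‖ * x⁻¹) atTop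
      (𝓝 0) := by
    simpa using ((tendsto_eval_div_pow_natDegree D).norm.const_mul C).mul tendsto_inv_atTop_zero
  have hle : ‖q.leadingCoeff‖ ≤ 0 := by
    refine le_of_tendsto_of_tendsto (tendsto_eval_div_pow_natDegree q).norm hlim ?_
    filter_upwards [eventually_ge_atTop 1] with x hx
    have hx0 : 0 < x := zero_lt_one.trans_le hx
    obtain ⟨d, hd⟩ := Nat.exists_eq_add_of_lt hlt
    rw [hd, norm_div, norm_div, norm_pow, norm_pow, Complex.norm_real, Real.norm_of_nonneg hx0.le,
      div_le_iff₀ (by positivity)]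
    have hpow : C * (‖D.eval (x : ℂ)‖ / x ^ D.natDegree) * x⁻¹ * x ^ (D.natDegree + d + 1)
        = C * ‖D.eval (x : ℂ)‖ * x ^ d := by
      field_simp; ring
    rw [hpow]
    exact (h x hx0.le).trans (le_mul_of_one_le_right ((norm_nonneg _).trans (h x hx0.le))
      (one_le_pow₀ hx))
  have : q = 0 := Polynomial.leadingCoeff_eq_zero.1 (norm_le_zero_iff.1 hle)
  simp [this] at hlt

/-- Two functions, holomorphic in the right and in the left half-plane, continuous up to the
imaginary axis and equal there, are restrictions of one polynomial if they have polynomial growth;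
its degree is controlled by the growth in the right half-plane. -/
lemma exists_polynomial_of_glue {D : Polynomial ℂ} {C : ℝ}
    (hf : ContinuousOn f {z | 0 ≤ z.re}) (hf' : DifferentiableOn ℂ f {z | 0 < z.re})
    (hg : ContinuousOn g {z | z.re ≤ 0}) (hg' : DifferentiableOn ℂ g {z | z.re < 0})
    (heq : ∀ z : ℂ, z.re = 0 → f z = g z)
    (hfC : ∀ z : ℂ, 0 ≤ z.re → ‖f z‖ ≤ C * ‖D.eval z‖)
    (hgC : PolyGrowthOn g {z | z.re ≤ 0}) :
    ∃ q : Polynomial ℂ, q.natDegree ≤ D.natDegree ∧ (∀ z : ℂ, 0 ≤ z.re → f z = q.eval z) ∧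
      ∀ z : ℂ, z.re ≤ 0 → g z = q.eval z := by
  classical
  set F : ℂ → ℂ := fun z => if 0 ≤ z.re then f z else g z with hF
  have hFf : ∀ z : ℂ, 0 ≤ z.re → F z = f z := fun z hz => if_pos hz
  have hFg : ∀ z : ℂ, z.re ≤ 0 → F z = g z := fun z hz => by
    rcases hz.lt_or_eq with h | h
    · exact if_neg h.not_ge
    · rw [hFf z h.ge, heq z h]
  have hcont : Continuous F := by
    rw [← continuousOn_univ]
    have : (Set.univ : Set ℂ) = {z | 0 ≤ z.re} ∪ {z | z.re ≤ 0} := by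
      ext z; simpa using le_total 0 z.re
    rw [this]
    exact (hf.congr hFf).union_of_isClosed (hg.congr hFg)
      (isClosed_le continuous_const Complex.continuous_re)
      (isClosed_le Complex.continuous_re continuous_const)
  have hdiff : DifferentiableOn ℂ F {z | z.re ≠ 0} := by
    have : {z : ℂ | z.re ≠ 0} = {z | 0 < z.re} ∪ {z | z.re < 0} := by
      ext z; simp [or_comm, lt_or_lt_iff_ne]
    rw [this]
    exact (hf'.congr fun z hz => hFf z (le_of_lt hz)).union_of_isOpen
      (hg'.congr fun z hz => hFg z (le_of_lt hz))
      (isOpen_lt continuous_const Complex.continuous_re)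
      (isOpen_lt Complex.continuous_re continuous_const)
  have hgrow : PolyGrowthOn F Set.univ := by
    have h₁ : PolyGrowthOn f {z | 0 ≤ z.re} := by
      obtain ⟨C', n, hC', hle⟩ := polyGrowthOn_eval D (U := Set.univ)
      refine ⟨|C| * C', n, by positivity, fun z hz => (hfC z hz).trans ?_⟩
      rw [mul_assoc]
      exact mul_le_mul (le_abs_self C) (hle z trivial) (norm_nonneg _) (abs_nonneg C)
    obtain ⟨C₁, n₁, h₁0, h₁⟩ := h₁
    obtain ⟨C₂, n₂, h₂0, h₂⟩ := hgC
    refine ⟨C₁ + C₂, n₁ + n₂, add_nonneg h₁0 h₂0, fun z _ => ?_⟩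
    have hone : 1 ≤ 1 + ‖z‖ := le_add_of_nonneg_right (norm_nonneg z)
    rcases le_total 0 z.re with h | h
    · rw [hFf z h]
      refine (h₁ z h).trans (mul_le_mul (le_add_of_nonneg_right h₂0) ?_ (by positivity)
        (by positivity))
      exact pow_le_pow_right₀ hone (Nat.le_add_right _ _)
    · rw [hFg z h]
      refine (h₂ z h).trans (mul_le_mul (le_add_of_nonneg_left h₁0) ?_ (by positivity)
        (by positivity))
      exact pow_le_pow_right₀ hone (Nat.le_add_left _ _)
  obtain ⟨q, hq⟩ := exists_polynomial_of_polyGrowthOn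
    (differentiable_of_differentiableOn_re_ne_zero hcont hdiff) hgrow
  have hfq : ∀ z : ℂ, 0 ≤ z.re → f z = q.eval z := fun z hz => by rw [← hFf z hz, hq]
  refine ⟨q, natDegree_le_of_norm_eval_le (C := C) fun x hx => ?_, hfq,
    fun z hz => by rw [← hFg z hz, hq]⟩
  rw [← hfq x (by simpa using hx)]
  exact hfC x (by simpa using hx)

end Gluing

/-! ### Laplace transforms of complex measures on the half-line -/

section Laplace

variable {X : Type*} [MeasurableSpace X] {θ : Measure X} {G : X → ℂ} {Y : X → ℝ}

/-- The Laplace transform of the image under `Y` of the complex measure with density `G` with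
respect to `θ`. -/
noncomputable def laplace (θ : Measure X) (G : X → ℂ) (Y : X → ℝ) (s : ℂ) : ℂ :=
  ∫ x, G x * Complex.exp (-s * (Y x : ℂ)) ∂θ

lemma norm_exp_neg_mul_le_one {s : ℂ} (hs : 0 ≤ s.re) {y : ℝ} (hy : 0 ≤ y) :
    ‖Complex.exp (-s * (y : ℂ))‖ ≤ 1 := by
  rw [Complex.norm_exp, Real.exp_le_one_iff]
  simpa using mul_nonneg hs hy

lemma laplace_aestronglyMeasurable (hG : Integrable G θ) (hY : AEMeasurable Y θ) (s : ℂ) :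
    AEStronglyMeasurable (fun x => G x * Complex.exp (-s * (Y x : ℂ))) θ := by
  refine hG.1.mul (AEMeasurable.aestronglyMeasurable ?_)
  fun_prop

lemma norm_laplace_integrand_le (hY0 : ∀ᵐ x ∂θ, 0 ≤ Y x) {s : ℂ} (hs : 0 ≤ s.re) :
    ∀ᵐ x ∂θ, ‖G x * Complex.exp (-s * (Y x : ℂ))‖ ≤ ‖G x‖ := by
  filter_upwards [hY0] with x hx
  rw [norm_mul]
  exact mul_le_of_le_one_right (norm_nonneg _) (norm_exp_neg_mul_le_one hs hx)

lemma integrable_laplace (hG : Integrable G θ) (hY : AEMeasurable Y θ) (hY0 : ∀ᵐ x ∂θ, 0 ≤ Y x)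
    {s : ℂ} (hs : 0 ≤ s.re) : Integrable (fun x => G x * Complex.exp (-s * (Y x : ℂ))) θ :=
  hG.norm.mono' (laplace_aestronglyMeasurable hG hY s) (norm_laplace_integrand_le hY0 hs)

lemma norm_laplace_le (hG : Integrable G θ) (hY0 : ∀ᵐ x ∂θ, 0 ≤ Y x) {s : ℂ} (hs : 0 ≤ s.re) :
    ‖laplace θ G Y s‖ ≤ ∫ x, ‖G x‖ ∂θ :=
  norm_integral_le_of_norm_le hG.norm (norm_laplace_integrand_le hY0 hs)

lemma continuousOn_laplace (hG : Integrable G θ) (hY : AEMeasurable Y θ)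
    (hY0 : ∀ᵐ x ∂θ, 0 ≤ Y x) : ContinuousOn (laplace θ G Y) {s | 0 ≤ s.re} := by
  refine continuousOn_of_dominated (bound := fun x => ‖G x‖)
    (fun s _ => laplace_aestronglyMeasurable hG hY s)
    (fun s hs => norm_laplace_integrand_le hY0 hs) hG.norm (.of_forall fun x => ?_)
  fun_prop

lemma differentiableOn_laplace (hG : Integrable G θ) (hY : AEMeasurable Y θ)
    (hY0 : ∀ᵐ x ∂θ, 0 ≤ Y x) : DifferentiableOn ℂ (laplace θ G Y) {s | 0 < s.re} := by
  intro s₀ hs₀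
  have hs₀ : 0 < s₀.re := hs₀
  set δ := s₀.re / 2 with hδ
  have hδ0 : 0 < δ := half_pos hs₀
  have hnhds : {s : ℂ | δ < s.re} ∈ 𝓝 s₀ :=
    (isOpen_lt continuous_const Complex.continuous_re).mem_nhds (half_lt_self hs₀)
  refine DifferentiableAt.differentiableWithinAt ?_
  refine (hasDerivAt_integral_of_dominated_loc_of_deriv_le (bound := fun x => ‖G x‖ * δ⁻¹)
    (F' := fun s x => G x * (Complex.exp (-s * (Y x : ℂ)) * (-1 * (Y x : ℂ)))) hnhds
    (.of_forall fun s => laplace_aestronglyMeasurable hG hY s)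
    (integrable_laplace hG hY hY0 hs₀.le) ?_ ?_ (hG.norm.mul_const _) ?_).2.differentiableAt
  · refine hG.1.mul (AEMeasurable.aestronglyMeasurable ?_)
    fun_prop
  · filter_upwards [hY0] with x hx s hs
    rw [norm_mul]
    refine mul_le_mul_of_nonneg_left ?_ (norm_nonneg _)
    have h1 : ‖Complex.exp (-s * (Y x : ℂ))‖ ≤ Real.exp (-(δ * Y x)) := by
      rw [Complex.norm_exp, Real.exp_le_exp]
      have : δ * Y x ≤ s.re * Y x := mul_le_mul_of_nonneg_right (le_of_lt hs) hx
      simpa using this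
    have h2 : δ * Y x ≤ Real.exp (δ * Y x) := by linarith [Real.add_one_le_exp (δ * Y x)]
    rw [norm_mul, norm_mul, norm_neg, norm_one, one_mul, Complex.norm_real, Real.norm_of_nonneg hx]
    calc ‖Complex.exp (-s * (Y x : ℂ))‖ * Y x ≤ Real.exp (-(δ * Y x)) * Y x :=
          mul_le_mul_of_nonneg_right h1 hx
      _ = (Real.exp (δ * Y x))⁻¹ * (δ * Y x) * δ⁻¹ := by rw [Real.exp_neg]; field_simp
      _ ≤ (Real.exp (δ * Y x))⁻¹ * Real.exp (δ * Y x) * δ⁻¹ := by gcongr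
      _ = δ⁻¹ := by rw [inv_mul_cancel₀ (Real.exp_pos _).ne', one_mul]
  · refine .of_forall fun x s _ => ?_
    have h := ((hasDerivAt_id s).neg.mul_const (Y x : ℂ)).cexp.const_mul (G x)
    simpa using h

end Laplace

/-! ### One step of the chain in the transform domain -/

section Step

variable {N : ℕ} (M : Model N)

/-- The function `(w, i) ↦ exp (-s w)` on the state `i = j` and `0` elsewhere, with negative levels
`w` replaced by `0` to make it bounded for `0 ≤ re s`. -/
noncomputable def levelExp (j : Fin N) (s : ℂ) (x : ℝ × Fin N) : ℂ :=
  if x.2 = j then Complex.exp (-s * (max x.1 0 : ℝ)) else 0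

lemma measurable_levelExp (j : Fin N) (s : ℂ) : Measurable (levelExp j s) := by
  refine Measurable.ite (measurable_snd (measurableSet_singleton j)) ?_ measurable_const
  fun_prop

lemma norm_levelExp_le (j : Fin N) {s : ℂ} (hs : 0 ≤ s.re) (x : ℝ × Fin N) :
    ‖levelExp j s x‖ ≤ 1 := by
  unfold levelExp
  split_ifs
  · exact norm_exp_neg_mul_le_one hs (le_max_right _ _)
  · simp

/-- The transform, on the state `j`, of the complex measure with density `F` with respect to
`ρ`. -/
noncomputable def stateTransform (ρ : Measure (ℝ × Fin N)) (F : ℝ × Fin N → ℂ) (j : Fin N) :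
    ℂ → ℂ :=
  laplace (ρ.restrict {x | x.2 = j}) F Prod.fst

/-- The level before taking the positive part. -/
def freeLevel (q : (ℝ × Fin N) × ℝ × ℝ × ℝ) : ℝ := q.2.1 * q.1.1 + q.2.2.1 - q.2.2.2

lemma measurable_freeLevel : Measurable (freeLevel (N := N)) := by
  unfold freeLevel; fun_prop

/-- The joint law of the present state, on `Z = i`, and of the increment towards the state `j`. -/
noncomputable def Model.stepLaw (ρ : Measure (ℝ × Fin N)) (i j : Fin N) :
    Measure ((ℝ × Fin N) × ℝ × ℝ × ℝ) :=
  (ρ.restrict {x | x.2 = i}).prod (M.incr i j)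

/-- The transform of the positive part of the new level, on `Z = i` and towards the state `j`. -/
noncomputable def Model.posPart (ρ : Measure (ℝ × Fin N)) (F : ℝ × Fin N → ℂ) (i j : Fin N) :
    ℂ → ℂ :=
  laplace (M.stepLaw ρ i j) (fun q => F q.1) fun q => max (freeLevel q) 0

/-- The transform of the negative part of the new level, on `Z = i` and towards the state `j`. -/
noncomputable def Model.negPart (ρ : Measure (ℝ × Fin N)) (F : ℝ × Fin N → ℂ) (i j : Fin N) :
    ℂ → ℂ :=
  laplace (M.stepLaw ρ i j) (fun q => F q.1) fun q => max (-freeLevel q) 0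

/-- The transform of `-V * W`, on `Z = i`. -/
noncomputable def Model.scaled (ρ : Measure (ℝ × Fin N)) (F : ℝ × Fin N → ℂ) (i : Fin N) :
    ℂ → ℂ :=
  laplace ((ρ.restrict {x | x.2 = i}).prod M.lawV) (fun q => F q.1) fun q => -q.2 * q.1.1

variable {ρ : Measure (ℝ × Fin N)} {F : ℝ × Fin N → ℂ}

lemma Model.integrable_stepLaw (hF : Integrable F ρ) (i j : Fin N) :
    Integrable (fun q => F q.1) (M.stepLaw ρ i j) :=
  hF.restrict.comp_fst (ν := M.incr i j)

lemma Model.integrable_scaled (hF : Integrable F ρ) (i : Fin N) :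
    Integrable (fun q : (ℝ × Fin N) × ℝ => F q.1) ((ρ.restrict {x | x.2 = i}).prod M.lawV) :=
  hF.restrict.comp_fst (ν := M.lawV)

lemma Model.ae_nonneg_scaled (hV : ∀ᵐ v ∂M.lawV, v < 0) (hρ : ∀ᵐ x ∂ρ, 0 ≤ x.1) (i : Fin N) :
    ∀ᵐ q ∂(ρ.restrict {x | x.2 = i}).prod M.lawV, 0 ≤ -q.2 * q.1.1 := by
  have h₁ := (Measure.quasiMeasurePreserving_fst (μ := ρ.restrict {x | x.2 = i})
    (ν := M.lawV)).ae (ae_restrict_of_ae hρ)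
  have h₂ := (Measure.quasiMeasurePreserving_snd (μ := ρ.restrict {x | x.2 = i})
    (ν := M.lawV)).ae hV
  filter_upwards [h₁, h₂] with q hq₁ hq₂
  exact mul_nonneg (neg_nonneg.2 hq₂.le) hq₁

lemma Model.integral_levelExp_step (j : Fin N) {s : ℂ} (hs : 0 ≤ s.re) (x : ℝ × Fin N) :
    ∫ y, levelExp j s y ∂M.step x
      = M.P x.2 j * ∫ u, Complex.exp (-s * (max (freeLevel (x, u)) 0 : ℝ)) ∂M.incr x.2 j := by
  rw [M.integral_step (measurable_levelExp j s).stronglyMeasurable (norm_levelExp_le j hs),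
    Finset.sum_eq_single j]
  · simp [levelExp, freeLevel]
  · intro k _ hk
    simp [levelExp, hk]
  · simp

variable [SFinite ρ]

/-- The transform of the law after one step, as a sum over the present state. -/
lemma Model.integral_step_eq_sum_posPart (hF : Integrable F ρ) (j : Fin N) {s : ℂ}
    (hs : 0 ≤ s.re) :
    ∫ x, F x * ∫ y, levelExp j s y ∂M.step x ∂ρ = ∑ i, (M.P i j : ℂ) * M.posPart ρ F i j s := by
  have hi : ∀ i : Fin N, MeasurableSet {x : ℝ × Fin N | x.2 = i} := fun i =>
    measurable_snd (measurableSet_singleton i)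
  have hint : Integrable (fun x => F x * ∫ y, levelExp j s y ∂M.step x) ρ := by
    refine hF.mul_bdd (c := 1) ?_ (.of_forall fun x => ?_)
    · exact ((measurable_levelExp j s).stronglyMeasurable.integral_kernel
        (κ := M.kernel)).aestronglyMeasurable
    · refine (norm_integral_le_of_norm_le_const (C := 1)
        (.of_forall (norm_levelExp_le j hs))).trans ?_
      simp
  conv_lhs => rw [← sum_restrict_state measurable_snd ρ]
  rw [integral_finsetSum_measure fun i _ => hint.restrict]
  refine Finset.sum_congr rfl fun i _ => ?_
  rw [Model.posPart, laplace, Model.stepLaw, integral_prod, ← integral_const_mul]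
  · refine setIntegral_congr_fun (hi i) fun x (hx : x.2 = i) => ?_
    simp only [M.integral_levelExp_step j hs, hx, integral_const_mul]
    ring
  · exact integrable_laplace (M.integrable_stepLaw hF i j)
      (measurable_freeLevel.max measurable_const).aemeasurable
      (.of_forall fun _ => le_max_right _ _) hs

/-- On the imaginary axis, `exp (-s X⁺) + exp (s X⁻) = 1 + exp (-s X)`, and the transform of
`X = V W + S - A` factorizes. -/
lemma Model.posPart_add_negPart (hF : Integrable F ρ) (i j : Fin N) {s : ℂ} (hs : s.re = 0) :
    M.posPart ρ F i j s + M.negPart ρ F i j (-s)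
      = stateTransform ρ F i 0 + lst (M.lawS i) s * lst (M.lawA j) (-s) * M.scaled ρ F i (-s) := by
  have hG := M.integrable_stepLaw hF i j
  have hY := measurable_freeLevel (N := N)
  have hY' : Measurable fun q => -freeLevel (N := N) q := hY.neg
  have hexp : ∀ y : ℝ, ‖Complex.exp (-s * (y : ℂ))‖ ≤ 1 := fun y => by
    rw [Complex.norm_exp]; simp [hs]
  have hfree : Integrable (fun q => F q.1 * Complex.exp (-s * (freeLevel q : ℂ)))
      (M.stepLaw ρ i j) :=
    hG.mul_bdd (c := 1) (Measurable.aestronglyMeasurable (by fun_prop)) (.of_forall fun q => hexp _)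
  rw [Model.posPart, Model.negPart, laplace, laplace, ← integral_add
    (integrable_laplace hG (hY.max measurable_const).aemeasurable
      (.of_forall fun _ => le_max_right _ _) hs.ge)
    (integrable_laplace hG (hY'.max measurable_const).aemeasurable
      (.of_forall fun _ => le_max_right _ _) (by simp [hs]))]
  have hsplit : ∀ q : (ℝ × Fin N) × ℝ × ℝ × ℝ,
      F q.1 * Complex.exp (-s * (max (freeLevel q) 0 : ℝ))
        + F q.1 * Complex.exp (- -s * (max (-freeLevel q) 0 : ℝ))
      = F q.1 + F q.1 * Complex.exp (-s * (freeLevel q : ℂ)) := by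
    intro q
    rcases le_total (freeLevel q) 0 with h | h
    · rw [max_eq_right h, max_eq_left (neg_nonneg.2 h)]; simp
    · rw [max_eq_left h, max_eq_right (neg_nonpos.2 h)]; simp [add_comm]
  simp only [hsplit]
  rw [integral_add hG hfree]
  congr 1
  · rw [Model.stepLaw, integral_fun_fst]
    simp [stateTransform, laplace]
  · rw [Model.stepLaw, integral_prod _ hfree, Model.scaled, laplace, integral_prod]
    · rw [← integral_const_mul]
      refine integral_congr_ae (.of_forall fun x => ?_)
      have hfac : ∀ u : ℝ × ℝ × ℝ, F x * Complex.exp (-s * (freeLevel (x, u) : ℂ))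
          = (F x * Complex.exp (- -s * ((-u.1 * x.1 : ℝ) : ℂ)))
            * (Complex.exp (-s * (u.2.1 : ℂ)) * Complex.exp (- -s * (u.2.2 : ℂ))) := by
        intro u
        rw [mul_assoc, ← Complex.exp_add, ← Complex.exp_add, freeLevel]
        congr 2
        push_cast
        ring
      simp only [hfac]
      rw [Model.incr,
        integral_prod_mul (fun v : ℝ => F x * Complex.exp (- -s * ((-v * x.1 : ℝ) : ℂ)))
        (fun w : ℝ × ℝ => Complex.exp (-s * (w.1 : ℂ)) * Complex.exp (- -s * (w.2 : ℂ))),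
        integral_prod_mul (fun b : ℝ => Complex.exp (-s * (b : ℂ)))
        (fun a : ℝ => Complex.exp (- -s * (a : ℂ)))]
      simp only [lst]
      ring
    · exact (M.integrable_scaled hF i).mul_bdd (c := 1)
        (Measurable.aestronglyMeasurable (by fun_prop)) (.of_forall fun q => by
          rw [Complex.norm_exp]; simp [hs])

/-- The transform of `-V * W` is the mean over `V` of the dilated transform of `W`. -/
lemma Model.scaled_eq_integral (hF : Integrable F ρ) (hρ : ∀ᵐ x ∂ρ, 0 ≤ x.1)
    (hV : ∀ᵐ v ∂M.lawV, v < 0) (i : Fin N) {s : ℂ} (hs : s.re ≤ 0) :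
    M.scaled ρ F i (-s) = ∫ y in Set.Iio (0 : ℝ), stateTransform ρ F i (s * y) ∂M.lawV := by
  have hres : M.lawV.restrict (Set.Iio 0) = M.lawV := Measure.restrict_eq_self_of_ae_mem hV
  rw [hres, Model.scaled, laplace, integral_prod_symm]
  · refine integral_congr_ae (.of_forall fun y => ?_)
    refine integral_congr_ae (.of_forall fun x => ?_)
    simp only
    congr 2
    push_cast
    ring
  · refine integrable_laplace (M.integrable_scaled hF i) ?_ (M.ae_nonneg_scaled hV hρ i) (by simpa)
    fun_prop

end Step

/-! ### Rational transforms after one step -/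

section Numerator

variable {N : ℕ} {m : Fin N → ℕ} (t : (k : Fin N) → Fin (m k) → ℂ)

/-- The denominator `denom t k` as a polynomial. -/
noncomputable def denomPoly (k : Fin N) : Polynomial ℂ :=
  ∏ f : Fin (m k), (Polynomial.X - Polynomial.C (t k f))

lemma denom_eq_eval (k : Fin N) (s : ℂ) : denom t k s = (denomPoly t k).eval s := by
  simp [denom, denomPoly, Polynomial.eval_prod]

/-- The product of all denominators as a polynomial. -/
noncomputable def fullDenom : Polynomial ℂ := ∏ k, denomPoly t k

lemma prod_denom_eq_eval (s : ℂ) : ∏ k, denom t k s = (fullDenom t).eval s := by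
  simp [fullDenom, denom_eq_eval, Polynomial.eval_prod]

lemma natDegree_fullDenom : (fullDenom t).natDegree = ∑ k, m k := by
  unfold fullDenom denomPoly
  rw [Polynomial.natDegree_prod_of_monic _ _ fun k _ =>
    Polynomial.monic_prod_X_sub_C _ _]
  exact Finset.sum_congr rfl fun k _ => by simp

variable {t}

lemma denom_ne_zero (ht : ∀ k f, (t k f).re < 0) (k : Fin N) {s : ℂ} (hs : 0 ≤ s.re) :
    denom t k s ≠ 0 := by
  refine Finset.prod_ne_zero_iff.2 fun f _ h => ?_
  have := ht k f
  rw [← sub_eq_zero.1 h] at this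
  exact this.not_ge hs

lemma fullDenom_ne_zero (ht : ∀ k f, (t k f).re < 0) {s : ℂ} (hs : 0 ≤ s.re) :
    (fullDenom t).eval s ≠ 0 := by
  rw [← prod_denom_eq_eval]
  exact Finset.prod_ne_zero_iff.2 fun k _ => denom_ne_zero ht k hs

lemma fullDenom_root (k : Fin N) (f : Fin (m k)) : (fullDenom t).eval (t k f) = 0 := by
  rw [← prod_denom_eq_eval]
  exact Finset.prod_eq_zero (Finset.mem_univ k)
    (Finset.prod_eq_zero (Finset.mem_univ f) (sub_self _))

lemma lst_eq_laplace (η : Measure ℝ) (s : ℂ) : lst η s = laplace η (fun _ => 1) id s := by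
  simp [lst, laplace]

section Reflect

variable {X : Type*} [MeasurableSpace X] {θ : Measure X} {G : X → ℂ} {Y : X → ℝ}

lemma continuousOn_laplace_neg (hG : Integrable G θ) (hY : AEMeasurable Y θ)
    (hY0 : ∀ᵐ x ∂θ, 0 ≤ Y x) : ContinuousOn (fun s => laplace θ G Y (-s)) {s | s.re ≤ 0} :=
  (continuousOn_laplace hG hY hY0).comp continuousOn_neg fun s (hs : s.re ≤ 0) => by simpa

lemma differentiableOn_laplace_neg (hG : Integrable G θ) (hY : AEMeasurable Y θ)
    (hY0 : ∀ᵐ x ∂θ, 0 ≤ Y x) :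
    DifferentiableOn ℂ (fun s => laplace θ G Y (-s)) {s | s.re < 0} :=
  (differentiableOn_laplace hG hY hY0).comp differentiableOn_id.neg
    fun s (hs : s.re < 0) => by simpa

lemma polyGrowthOn_laplace_neg (hG : Integrable G θ) (hY0 : ∀ᵐ x ∂θ, 0 ≤ Y x) :
    PolyGrowthOn (fun s => laplace θ G Y (-s)) {s | s.re ≤ 0} :=
  .of_bound fun s (hs : s.re ≤ 0) => norm_laplace_le hG hY0 (by simpa)

end Reflect

variable {M : Model N} {num : Fin N → Polynomial ℂ} {ρ : Measure (ℝ × Fin N)} [SFinite ρ]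
  {F : ℝ × Fin N → ℂ}

/-- After one step from any complex measure on nonnegative levels, the transform is a polynomial of
degree at most `∑ k, m k` divided by the product of the denominators. Multiplied by this product it
extends through the imaginary axis to the left half-plane, because the negative part of the new
level has a transform that is holomorphic there; at a zero `t k f` the contribution of the negative
part vanishes. -/
lemma Model.exists_numerator (hrat : HasRationalService M num t) (hV : ∀ᵐ v ∂M.lawV, v < 0)
    (hF : Integrable F ρ) (hρ : ∀ᵐ x ∂ρ, 0 ≤ x.1) (j : Fin N) :
    ∃ q : Polynomial ℂ, q.natDegree ≤ ∑ k, m k ∧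
      (∀ s : ℂ, 0 ≤ s.re →
        (∫ x, F x * ∫ y, levelExp j s y ∂M.step x ∂ρ) * ∏ k, denom t k s = q.eval s) ∧
      ∀ (k : Fin N) (f : Fin (m k)), q.eval (t k f)
        = lst (M.lawA j) (-(t k f)) *
          ∑ i : Fin N, (M.P i j : ℂ) * (num i).eval (t k f)
            * (∏ l ∈ Finset.univ.erase i, denom t l (t k f))
            * ∫ y in Set.Iio (0 : ℝ), stateTransform ρ F i (t k f * (y : ℂ)) ∂M.lawV := by
  obtain ⟨ht, hS⟩ := hrat
  set D := fullDenom t with hD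
  -- `R i` is `D` times the transform of `S` in the state `i`.
  set R : Fin N → Polynomial ℂ := fun i => num i * ∏ l ∈ Finset.univ.erase i, denomPoly t l with hR
  have hRD : ∀ i (s : ℂ), 0 ≤ s.re → lst (M.lawS i) s * D.eval s = (R i).eval s := by
    intro i s hs
    rw [hS i s hs, hD, ← prod_denom_eq_eval, ← Finset.mul_prod_erase _ _ (Finset.mem_univ i), hR]
    simp only [Polynomial.eval_mul, Polynomial.eval_prod, denom_eq_eval]
    have := denom_ne_zero ht i hs
    rw [denom_eq_eval] at this
    field_simp
  have hY := measurable_freeLevel (N := N)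
  have hY' : Measurable fun q => -freeLevel (N := N) q := hY.neg
  have hG := fun i => M.integrable_stepLaw hF i j
  have hp0 : ∀ i, ∀ᵐ q ∂M.stepLaw ρ i j, 0 ≤ max (freeLevel q) 0 := fun i =>
    .of_forall fun _ => le_max_right _ _
  have hn0 : ∀ i, ∀ᵐ q ∂M.stepLaw ρ i j, 0 ≤ max (-freeLevel q) 0 := fun i =>
    .of_forall fun _ => le_max_right _ _
  have hpm : ∀ i, AEMeasurable (fun q => max (freeLevel q) 0) (M.stepLaw ρ i j) := fun i =>
    (hY.max measurable_const).aemeasurable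
  have hnm : ∀ i, AEMeasurable (fun q => max (-freeLevel q) 0) (M.stepLaw ρ i j) := fun i =>
    (hY'.max measurable_const).aemeasurable
  have hsm : ∀ i, AEMeasurable (fun q : (ℝ × Fin N) × ℝ => -q.2 * q.1.1)
      ((ρ.restrict {x | x.2 = i}).prod M.lawV) := fun i => by fun_prop
  have hA1 : Integrable (fun _ : ℝ => (1 : ℂ)) (M.lawA j) := integrable_const 1
  have hlst : lst (M.lawA j) = laplace (M.lawA j) (fun _ => 1) id :=
    funext fun s => lst_eq_laplace _ s
  set f : ℂ → ℂ := fun s => (∑ i, (M.P i j : ℂ) * M.posPart ρ F i j s) * D.eval s with hf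
  set g : ℂ → ℂ := fun s => ∑ i, (M.P i j : ℂ) *
    ((R i).eval s * (lst (M.lawA j) (-s) * M.scaled ρ F i (-s))
      + D.eval s * (stateTransform ρ F i 0 + (-1) * M.negPart ρ F i j (-s))) with hg
  have hbound : ∀ s : ℂ, 0 ≤ s.re → ‖f s‖
      ≤ (∑ i, ‖(M.P i j : ℂ)‖ * ∫ q, ‖F q.1‖ ∂M.stepLaw ρ i j) * ‖D.eval s‖ := by
    intro s hs
    rw [hf, norm_mul]
    refine mul_le_mul_of_nonneg_right ((norm_sum_le _ _).trans ?_) (norm_nonneg _)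
    refine Finset.sum_le_sum fun i _ => ?_
    rw [norm_mul]
    exact mul_le_mul_of_nonneg_left (norm_laplace_le (hG i) (hp0 i) hs) (norm_nonneg _)
  have hf₁ : ContinuousOn f {s | 0 ≤ s.re} := by
    refine ContinuousOn.mul (continuousOn_finsetSum _ fun i _ => continuousOn_const.mul ?_)
      D.continuous.continuousOn
    exact continuousOn_laplace (hG i) (hpm i) (hp0 i)
  have hf₂ : DifferentiableOn ℂ f {s | 0 < s.re} := by
    refine DifferentiableOn.mul (DifferentiableOn.fun_sum fun i _ =>
      (differentiableOn_const _).mul ?_) D.differentiable.differentiableOn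
    exact differentiableOn_laplace (hG i) (hpm i) (hp0 i)
  have hg₁ : ContinuousOn g {s | s.re ≤ 0} := by
    refine continuousOn_finsetSum _ fun i _ => continuousOn_const.mul
      (((R i).continuous.continuousOn.mul (ContinuousOn.mul ?_ ?_)).add
        (D.continuous.continuousOn.mul (continuousOn_const.add (continuousOn_const.mul ?_))))
    · rw [hlst]
      exact continuousOn_laplace_neg hA1 aemeasurable_id (M.nonneg_A j)
    · exact continuousOn_laplace_neg (M.integrable_scaled hF i) (hsm i) (M.ae_nonneg_scaled hV hρ i)
    · exact continuousOn_laplace_neg (hG i) (hnm i) (hn0 i)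
  have hg₂ : DifferentiableOn ℂ g {s | s.re < 0} := by
    refine DifferentiableOn.fun_sum fun i _ => (differentiableOn_const _).mul
      (((R i).differentiable.differentiableOn.mul (DifferentiableOn.mul ?_ ?_)).add
        (D.differentiable.differentiableOn.mul
          ((differentiableOn_const _).add ((differentiableOn_const _).mul ?_))))
    · rw [hlst]
      exact differentiableOn_laplace_neg hA1 aemeasurable_id (M.nonneg_A j)
    · exact differentiableOn_laplace_neg (M.integrable_scaled hF i) (hsm i)
        (M.ae_nonneg_scaled hV hρ i)
    · exact differentiableOn_laplace_neg (hG i) (hnm i) (hn0 i)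
  have hfg : ∀ s : ℂ, s.re = 0 → f s = g s := by
    intro s hs
    simp only [hf, hg, Finset.sum_mul]
    refine Finset.sum_congr rfl fun i _ => ?_
    have h := M.posPart_add_negPart hF i j hs
    rw [← hRD i s hs.ge]
    linear_combination (M.P i j : ℂ) * D.eval s * h
  have hg₃ : PolyGrowthOn g {s | s.re ≤ 0} := by
    refine .finsetSum _ fun i _ => .mul (.of_bound fun _ _ => le_rfl)
      (((polyGrowthOn_eval (R i)).mul (.mul ?_ ?_)).add ((polyGrowthOn_eval D).mul
        (.add (.of_bound fun _ _ => le_rfl) (.mul (.of_bound fun _ _ => le_rfl) ?_))))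
    · rw [hlst]
      exact polyGrowthOn_laplace_neg hA1 (M.nonneg_A j)
    · exact polyGrowthOn_laplace_neg (M.integrable_scaled hF i) (M.ae_nonneg_scaled hV hρ i)
    · exact polyGrowthOn_laplace_neg (hG i) (hn0 i)
  obtain ⟨q, hdeg, hfq, hgq⟩ := exists_polynomial_of_glue hf₁ hf₂ hg₁ hg₂ hfg hbound hg₃
  refine ⟨q, hdeg.trans (natDegree_fullDenom t).le, fun s hs => ?_, fun k fk => ?_⟩
  · rw [M.integral_step_eq_sum_posPart hF j hs, prod_denom_eq_eval]
    exact hfq s hs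
  · rw [← hgq _ (ht k fk).le, hg]
    simp only [hD, fullDenom_root, zero_mul, add_zero]
    rw [Finset.mul_sum]
    refine Finset.sum_congr rfl fun i _ => ?_
    rw [M.scaled_eq_integral hF hρ hV i (ht k fk).le, hR]
    simp only [Polynomial.eval_mul, Polynomial.eval_prod, ← denom_eq_eval]
    ring

end Numerator

/-! ### Complex measures reproduced by the transition kernel -/

section TestFunctions

variable {N : ℕ}

/-- Test functions: bounded measurable functions whose restriction to nonnegative levels extends
continuously to the level `∞`, that is, is a continuous function of `exp (-w)`. -/
def IsTest (φ : ℝ × Fin N → ℝ) : Prop :=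
  Measurable φ ∧ (∃ a b, ∀ x, φ x ∈ Set.Icc a b) ∧
    ∃ ψ : Fin N → ℝ → ℝ, (∀ i, Continuous (ψ i)) ∧
      ∀ x : ℝ × Fin N, 0 ≤ x.1 → φ x = ψ x.2 (Real.exp (-x.1))

/-- The value of `exp (-max (v w + b - a) 0)` in terms of `r = exp (-w)`. For `v < 0` it is
continuous up to `r = 0`, with the value `1` there. -/
noncomputable def nextExp (r : ℝ) (u : ℝ × ℝ × ℝ) : ℝ :=
  (max 1 (r ^ (-u.1) * Real.exp (u.2.1 - u.2.2)))⁻¹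

lemma nextExp_exp_neg (w : ℝ) (u : ℝ × ℝ × ℝ) :
    nextExp (Real.exp (-w)) u = Real.exp (-max (u.1 * w + u.2.1 - u.2.2) 0) := by
  rw [nextExp, ← Real.exp_mul, ← Real.exp_add, Real.exp_neg, Real.exp_monotone.map_max,
    Real.exp_zero, max_comm]
  congr 3
  ring

lemma nextExp_mem_Icc (r : ℝ) (u : ℝ × ℝ × ℝ) : nextExp r u ∈ Set.Icc (0 : ℝ) 1 :=
  ⟨inv_nonneg.2 (zero_le_one.trans (le_max_left _ _)), inv_le_one_of_one_le₀ (le_max_left _ _)⟩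

lemma continuous_nextExp {u : ℝ × ℝ × ℝ} (hu : u.1 < 0) : Continuous fun r => nextExp r u := by
  have h : Continuous fun r : ℝ => r ^ (-u.1) := Real.continuous_rpow_const (by linarith)
  exact (continuous_const.max (h.mul continuous_const)).inv₀ fun r =>
    (zero_lt_one.trans_le (le_max_left _ _)).ne'

lemma measurable_nextExp (r : ℝ) : Measurable (nextExp r) := by
  unfold nextExp; fun_prop

variable {M : Model N}

/-- Dominated convergence shows that the transition operator preserves test functions. -/
lemma IsTest.transOp (hV : ∀ᵐ v ∂M.lawV, v < 0) {φ : ℝ × Fin N → ℝ} (hφ : IsTest φ) :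
    IsTest (transOp M.kernel φ) := by
  obtain ⟨hm, ⟨a, b, hab⟩, ψ, hψ, hφψ⟩ := hφ
  refine ⟨measurable_transOp hm, ⟨a, b, transOp_mem_Icc hm hab⟩,
    fun i r => ∑ j, M.P i j * ∫ u, ψ j (nextExp r u) ∂M.incr i j, fun i => ?_, fun x hx => ?_⟩
  · refine continuous_finsetSum _ fun j _ => continuous_const.mul ?_
    obtain ⟨C, hC⟩ := (isCompact_Icc (a := (0 : ℝ)) (b := 1)).exists_bound_of_continuousOn
      (hψ j).continuousOn
    refine continuous_of_dominated (bound := fun _ => C)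
      (fun r => ((hψ j).measurable.comp (measurable_nextExp r)).aestronglyMeasurable)
      (fun r => .of_forall fun u => hC _ (nextExp_mem_Icc r u)) (integrable_const C) ?_
    have hV' := (Measure.quasiMeasurePreserving_fst (μ := M.lawV)
      (ν := (M.lawS i).prod (M.lawA j))).ae hV
    filter_upwards [hV'] with u hu using (hψ j).comp (continuous_nextExp hu)
  · rw [MarkovLindley.transOp, M.kernel_apply, M.integral_step hm.stronglyMeasurable
      (C := max |a| |b|) fun y => abs_le_max_abs_abs (hab y).1 (hab y).2]
    refine Finset.sum_congr rfl fun j _ => ?_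
    rw [smul_eq_mul]
    congr 1
    refine integral_congr_ae (.of_forall fun u => ?_)
    simp only
    rw [hφψ _ (le_max_right _ _), nextExp_exp_neg]

lemma IsTest.iterate_transOp (hV : ∀ᵐ v ∂M.lawV, v < 0) {φ : ℝ × Fin N → ℝ} (hφ : IsTest φ)
    (k : ℕ) : IsTest ((MarkovLindley.transOp M.kernel)^[k] φ) := by
  induction k with
  | zero => exact hφ
  | succ k ih => rw [Function.iterate_succ_apply']; exact ih.transOp hV

/-- The function `(w, i) ↦ exp (-k w)` on the state `i = j`, truncated to nonnegative levels. -/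
noncomputable def expTest (j : Fin N) (k : ℕ) (x : ℝ × Fin N) : ℝ :=
  if x.2 = j then Real.exp (-max x.1 0) ^ k else 0

lemma measurable_expTest (j : Fin N) (k : ℕ) : Measurable (expTest j k) := by
  refine Measurable.ite (measurable_snd (measurableSet_singleton j)) ?_ measurable_const
  fun_prop

lemma expTest_mem_Icc (j : Fin N) (k : ℕ) (x : ℝ × Fin N) : expTest j k x ∈ Set.Icc (0 : ℝ) 1 := by
  unfold expTest
  split_ifs
  · exact ⟨by positivity, pow_le_one₀ (Real.exp_pos _).le (by simp)⟩
  · simp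

lemma isTest_expTest (j : Fin N) (k : ℕ) : IsTest (expTest j k) := by
  refine ⟨measurable_expTest j k, ⟨0, 1, expTest_mem_Icc j k⟩,
    fun i r => if i = j then r ^ k else 0, fun i => ?_, fun x hx => ?_⟩
  · dsimp only
    split_ifs <;> fun_prop
  · simp [expTest, hx]

lemma ofReal_expTest (j : Fin N) (k : ℕ) (x : ℝ × Fin N) :
    (expTest j k x : ℂ) = levelExp j k x := by
  unfold expTest levelExp
  split_ifs
  · push_cast
    rw [← Complex.exp_nat_mul]
    simp
  · simp

/-- By the Weierstrass theorem, a test function is uniformly approximated on nonnegative levels by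
linear combinations of the functions `expTest j k`. -/
lemma IsTest.exists_approx {φ : ℝ × Fin N → ℝ} (hφ : IsTest φ) {ε : ℝ} (hε : 0 < ε) :
    ∃ q : Fin N → Polynomial ℝ, ∀ x : ℝ × Fin N, 0 ≤ x.1 →
      |φ x - ∑ j, ∑ k ∈ (q j).support, (q j).coeff k * expTest j k x| ≤ ε := by
  obtain ⟨-, -, ψ, hψ, hφψ⟩ := hφ
  choose q hq using fun i => exists_polynomial_near_of_continuousOn 0 1 (ψ i)
    (hψ i).continuousOn ε hε
  refine ⟨q, fun x hx => ?_⟩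
  have hsum : ∑ j, ∑ k ∈ (q j).support, (q j).coeff k * expTest j k x
      = (q x.2).eval (Real.exp (-x.1)) := by
    rw [Finset.sum_eq_single x.2]
    · simp [expTest, hx, Polynomial.eval_eq_sum, Polynomial.sum]
    · intro j _ hj
      simp [expTest, hj.symm]
    · simp
  rw [hsum, hφψ x hx, abs_sub_comm]
  exact (hq x.2 _ ⟨(Real.exp_pos _).le, by simpa using hx⟩).le

variable {ρ : Measure (ℝ × Fin N)} {F : ℝ × Fin N → ℂ}

lemma integrable_mul_ofReal (hF : Integrable F ρ) {φ : ℝ × Fin N → ℝ} (hm : Measurable φ)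
    {a b : ℝ} (hab : ∀ x, φ x ∈ Set.Icc a b) : Integrable (fun x => F x * (φ x : ℂ)) ρ := by
  refine hF.mul_bdd (c := max |a| |b|) ?_ (.of_forall fun x => ?_)
  · exact (Complex.measurable_ofReal.comp hm).aestronglyMeasurable
  · rw [Complex.norm_real]
    exact abs_le_max_abs_abs (hab x).1 (hab x).2

lemma norm_integral_mul_ofReal_le (hF : Integrable F ρ) {φ : ℝ × Fin N → ℝ} {ε : ℝ}
    (hφ : ∀ᵐ x ∂ρ, |φ x| ≤ ε) : ‖∫ x, F x * (φ x : ℂ) ∂ρ‖ ≤ (∫ x, ‖F x‖ ∂ρ) * ε := by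
  rw [← integral_mul_const]
  refine norm_integral_le_of_norm_le (hF.norm.mul_const ε) ?_
  filter_upwards [hφ] with x hx
  rw [norm_mul, Complex.norm_real]
  exact mul_le_mul_of_nonneg_left hx (norm_nonneg _)

/-- A complex measure on nonnegative levels whose transforms at the natural numbers are reproduced
by one step of the chain integrates every test function as its image after one step does. -/
lemma integral_transOp_eq_of_expTest (hF : Integrable F ρ) (hρ : ∀ᵐ x ∂ρ, 0 ≤ x.1)
    (hinv : ∀ (j : Fin N) (k : ℕ), ∫ x, F x * (expTest j k x : ℂ) ∂ρ
      = ∫ x, F x * (transOp M.kernel (expTest j k) x : ℂ) ∂ρ)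
    {φ : ℝ × Fin N → ℝ} (hφ : IsTest φ) :
    ∫ x, F x * (φ x : ℂ) ∂ρ = ∫ x, F x * (transOp M.kernel φ x : ℂ) ∂ρ := by
  obtain ⟨hm, ⟨a, b, hab⟩, -⟩ := id hφ
  rw [← sub_eq_zero, ← norm_le_zero_iff]
  refine le_of_forall_pos_le_add fun δ hδ => ?_
  set K := ∫ x, ‖F x‖ ∂ρ with hK
  have hK0 : 0 ≤ K := integral_nonneg fun _ => norm_nonneg _
  have hε : 0 < δ / (2 * (K + 1)) := by positivity
  obtain ⟨q, hq⟩ := hφ.exists_approx hε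
  set ε := δ / (2 * (K + 1))
  set χ : ℝ × Fin N → ℝ := fun x => ∑ j, ∑ k ∈ (q j).support, (q j).coeff k * expTest j k x with hχ
  have hTχ : ∀ x, transOp M.kernel χ x
      = ∑ j, ∑ k ∈ (q j).support, (q j).coeff k * transOp M.kernel (expTest j k) x := by
    intro x
    have hi : ∀ (j : Fin N) (k : ℕ), Integrable (fun y => (q j).coeff k * expTest j k y)
        (M.kernel x) := fun j k =>
      (integrable_of_bounds (measurable_expTest j k) (expTest_mem_Icc j k)).const_mul _
    simp only [transOp, hχ]
    rw [integral_finsetSum _ fun j _ => integrable_finsetSum _ fun k _ => hi j k]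
    refine Finset.sum_congr rfl fun j _ => ?_
    rw [integral_finsetSum _ fun k _ => hi j k]
    exact Finset.sum_congr rfl fun k _ => integral_const_mul _ _
  have hχint : ∀ x, Integrable χ (M.kernel x) := fun x =>
    integrable_finsetSum _ fun j _ => integrable_finsetSum _ fun k _ =>
      (integrable_of_bounds (measurable_expTest j k) (expTest_mem_Icc j k)).const_mul _
  have hsum : ∀ ξ : Fin N → ℕ → ℝ × Fin N → ℝ, (∀ j k, Measurable (ξ j k)) →
      (∀ j k x, ξ j k x ∈ Set.Icc (0 : ℝ) 1) →
      Integrable (fun x => F x * ((∑ j, ∑ k ∈ (q j).support, (q j).coeff k * ξ j k x : ℝ) : ℂ)) ρ ∧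
      ∫ x, F x * ((∑ j, ∑ k ∈ (q j).support, (q j).coeff k * ξ j k x : ℝ) : ℂ) ∂ρ
        = ∑ j, ∑ k ∈ (q j).support, ((q j).coeff k : ℂ) * ∫ x, F x * (ξ j k x : ℂ) ∂ρ := by
    intro ξ hξm hξ
    have hexp : ∀ x, F x * ((∑ j, ∑ k ∈ (q j).support, (q j).coeff k * ξ j k x : ℝ) : ℂ)
        = ∑ j, ∑ k ∈ (q j).support, ((q j).coeff k : ℂ) * (F x * (ξ j k x : ℂ)) := by
      intro x
      push_cast
      simp only [Finset.mul_sum]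
      exact Finset.sum_congr rfl fun j _ => Finset.sum_congr rfl fun k _ => by ring
    have hi : ∀ j k, Integrable (fun x => ((q j).coeff k : ℂ) * (F x * (ξ j k x : ℂ))) ρ :=
      fun j k => (integrable_mul_ofReal hF (hξm j k) (hξ j k)).const_mul _
    simp only [hexp]
    refine ⟨integrable_finsetSum _ fun j _ => integrable_finsetSum _ fun k _ => hi j k, ?_⟩
    rw [integral_finsetSum _ fun j _ => integrable_finsetSum _ fun k _ => hi j k]
    refine Finset.sum_congr rfl fun j _ => ?_
    rw [integral_finsetSum _ fun k _ => hi j k]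
    exact Finset.sum_congr rfl fun k _ => integral_const_mul _ _
  obtain ⟨hi₁, h₁⟩ := hsum expTest measurable_expTest expTest_mem_Icc
  obtain ⟨hi₂, h₂⟩ := hsum (fun j k => transOp M.kernel (expTest j k))
    (fun j k => measurable_transOp (measurable_expTest j k))
    (fun j k => transOp_mem_Icc (measurable_expTest j k) (expTest_mem_Icc j k))
  -- `χ` is a finite combination of the functions of the hypothesis; `φ` is `ε`-close to it before
  -- the step, and after the step because the step leads to nonnegative levels.
  have hχinv : ∫ x, F x * (χ x : ℂ) ∂ρ = ∫ x, F x * (transOp M.kernel χ x : ℂ) ∂ρ := by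
    simp only [hTχ]
    rw [h₁, h₂]
    exact Finset.sum_congr rfl fun j _ => Finset.sum_congr rfl fun k _ => by rw [hinv j k]
  have hi₃ : Integrable (fun x => F x * (transOp M.kernel χ x : ℂ)) ρ := by
    simpa only [hTχ] using hi₂
  have hb₁ := norm_integral_mul_ofReal_le hF (φ := fun x => φ x - χ x) (ε := ε)
    (hρ.mono fun x hx => hq x hx)
  have hb₂ := norm_integral_mul_ofReal_le hF (ε := ε)
    (φ := fun x => transOp M.kernel φ x - transOp M.kernel χ x) (.of_forall fun x => by
      have hsub : transOp M.kernel φ x - transOp M.kernel χ x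
          = ∫ y, (φ y - χ y) ∂M.kernel x :=
        (integral_sub (integrable_of_bounds hm hab) (hχint x)).symm
      rw [hsub, ← Real.norm_eq_abs]
      refine (norm_integral_le_of_norm_le_const (C := ε) ?_).trans (by simp)
      filter_upwards [M.ae_nonneg_step x] with y hy using hq y hy)
  have hs₁ : ∫ x, F x * ((φ x - χ x : ℝ) : ℂ) ∂ρ
      = (∫ x, F x * (φ x : ℂ) ∂ρ) - ∫ x, F x * (χ x : ℂ) ∂ρ := by
    rw [← integral_sub (integrable_mul_ofReal hF hm hab) hi₁]
    exact integral_congr_ae (.of_forall fun x => by simp [hχ, mul_sub])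
  have hs₂ : ∫ x, F x * ((transOp M.kernel φ x - transOp M.kernel χ x : ℝ) : ℂ) ∂ρ
      = (∫ x, F x * (transOp M.kernel φ x : ℂ) ∂ρ) - ∫ x, F x * (transOp M.kernel χ x : ℂ) ∂ρ := by
    rw [← integral_sub (integrable_mul_ofReal hF (measurable_transOp hm)
      (transOp_mem_Icc hm hab)) hi₃]
    exact integral_congr_ae (.of_forall fun x => by simp [mul_sub])
  rw [hs₁] at hb₁
  rw [hs₂, ← hχinv] at hb₂
  have hfin : K * ε + K * ε ≤ δ := by
    have : (K + 1) * ε * 2 = δ := by simp only [ε]; field_simp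
    nlinarith
  calc _ = ‖((∫ x, F x * (φ x : ℂ) ∂ρ) - ∫ x, F x * (χ x : ℂ) ∂ρ)
          - ((∫ x, F x * (transOp M.kernel φ x : ℂ) ∂ρ) - ∫ x, F x * (χ x : ℂ) ∂ρ)‖ := by
        congr 1; ring
    _ ≤ K * ε + K * ε := (norm_sub_le _ _).trans (add_le_add hb₁ hb₂)
    _ ≤ 0 + δ := by linarith

/-- Such a complex measure is a multiple of the invariant law, as far as test functions are
concerned: iterating the transition operator turns a test function into a constant. -/
lemma integral_eq_of_expTest {z : ℝ × Fin N} {n : ℕ} {ε : ℝ} (hD : Doeblin M.kernel z n ε)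
    (hV : ∀ᵐ v ∂M.lawV, v < 0) {ν : Measure (ℝ × Fin N)} [IsProbabilityMeasure ν]
    (hν : ν.bind M.kernel = ν) (hF : Integrable F ρ) (hρ : ∀ᵐ x ∂ρ, 0 ≤ x.1)
    (hinv : ∀ (j : Fin N) (k : ℕ), ∫ x, F x * (expTest j k x : ℂ) ∂ρ
      = ∫ x, F x * (transOp M.kernel (expTest j k) x : ℂ) ∂ρ)
    {φ : ℝ × Fin N → ℝ} (hφ : IsTest φ) :
    ∫ x, F x * (φ x : ℂ) ∂ρ = (∫ x, F x ∂ρ) * ((∫ x, φ x ∂ν : ℝ) : ℂ) := by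
  obtain ⟨hm, ⟨a, b, hab⟩, -⟩ := id hφ
  have hiter : ∀ k, ∫ x, F x * (φ x : ℂ) ∂ρ
      = ∫ x, F x * ((transOp M.kernel)^[k] φ x : ℂ) ∂ρ := by
    intro k
    induction k with
    | zero => rfl
    | succ k ih =>
      rw [ih, integral_transOp_eq_of_expTest hF hρ hinv (hφ.iterate_transOp hV k),
        Function.iterate_succ_apply']
  set K := ∫ x, ‖F x‖ ∂ρ with hK
  have hK0 : 0 ≤ K := integral_nonneg fun _ => norm_nonneg _
  rw [← sub_eq_zero, ← norm_le_zero_iff]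
  refine le_of_forall_pos_le_add fun δ hδ => ?_
  obtain ⟨k, hk⟩ := (hD.tendstoUniformly hν hm hab (δ := δ / (K + 1)) (by positivity)).exists
  have hb := norm_integral_mul_ofReal_le hF (ε := δ / (K + 1))
    (φ := fun x => (transOp M.kernel)^[k] φ x - ∫ y, φ y ∂ν) (.of_forall hk)
  have hs : ∫ x, F x * (((transOp M.kernel)^[k] φ x - ∫ y, φ y ∂ν : ℝ) : ℂ) ∂ρ
      = (∫ x, F x * (φ x : ℂ) ∂ρ) - (∫ x, F x ∂ρ) * ((∫ x, φ x ∂ν : ℝ) : ℂ) := by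
    rw [hiter k, ← integral_mul_const, ← integral_sub (integrable_mul_ofReal hF
      (measurable_iterate_transOp hm k) (iterate_transOp_mem_Icc hm hab k)) (hF.mul_const _)]
    exact integral_congr_ae (.of_forall fun x => by simp [mul_sub])
  rw [hs] at hb
  refine hb.trans ?_
  rw [zero_add, mul_div_assoc', div_le_iff₀ (by positivity)]
  nlinarith

end TestFunctions

/-! ### Proper rational functions with simple poles as transforms -/

section PartialFractions

open Polynomial in
/-- Partial fractions, written with the functions `s / (s - t ω)`: interpolation at the nodes `0`
and `t ω`. -/
lemma exists_partial_fractions {ι : Type*} [Fintype ι] {t : ι → ℂ} (ht : Function.Injective t)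
    (ht0 : ∀ ω, t ω ≠ 0) {q : ℂ[X]} (hq : q.natDegree ≤ Fintype.card ι) :
    ∃ (a : ℂ) (β : ι → ℂ), ∀ s : ℂ, (∀ ω, s ≠ t ω) →
      q.eval s / ∏ ω, (s - t ω) = a + ∑ ω, β ω * (s / (s - t ω)) := by
  classical
  set L : ι → ℂ[X] := fun ω => ∏ ω' ∈ Finset.univ.erase ω, (X - C (t ω')) with hL
  set D : ℂ[X] := ∏ ω, (X - C (t ω)) with hD
  set a : ℂ := q.eval 0 / D.eval 0 with ha
  set β : ι → ℂ := fun ω => q.eval (t ω) / (t ω * (L ω).eval (t ω)) with hβ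
  have hLne : ∀ ω, (L ω).eval (t ω) ≠ 0 := fun ω => by
    simp only [hL, eval_prod, eval_sub, eval_X, eval_C]
    exact Finset.prod_ne_zero_iff.2 fun ω' hω' => sub_ne_zero.2 fun h =>
      (Finset.mem_erase.1 hω').1 (ht h).symm
  have hLz : ∀ ω ω', ω' ≠ ω → (L ω').eval (t ω) = 0 := fun ω ω' h => by
    simp only [hL, eval_prod, eval_sub, eval_X, eval_C]
    exact Finset.prod_eq_zero (Finset.mem_erase.2 ⟨h.symm, Finset.mem_univ ω⟩) (sub_self _)
  have hD0 : D.eval 0 ≠ 0 := by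
    simp only [hD, eval_prod, eval_sub, eval_X, eval_C]
    exact Finset.prod_ne_zero_iff.2 fun ω _ => by simpa using ht0 ω
  have hDz : ∀ ω, D.eval (t ω) = 0 := fun ω => by
    simp only [hD, eval_prod, eval_sub, eval_X, eval_C]
    exact Finset.prod_eq_zero (Finset.mem_univ ω) (sub_self _)
  have hXL : ∀ ω, (X * L ω).natDegree ≤ Fintype.card ι := fun ω => by
    refine natDegree_mul_le.trans ?_
    rw [hL, natDegree_prod_of_monic _ _ fun _ _ => monic_X_sub_C _]
    simp only [natDegree_X, natDegree_X_sub_C, Finset.sum_const, smul_eq_mul, mul_one,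
      Finset.card_erase_of_mem (Finset.mem_univ ω), Finset.card_univ]
    have : 0 < Fintype.card ι := Fintype.card_pos_iff.2 ⟨ω⟩
    omega
  have hDdeg : D.natDegree ≤ Fintype.card ι := by
    rw [hD, natDegree_prod_of_monic _ _ fun _ _ => monic_X_sub_C _]
    simp
  have key : q = C a * D + ∑ ω, C (β ω) * (X * L ω) := by
    refine eq_of_natDegree_lt_card_of_eval_eq' _ _ (insert 0 (Finset.univ.image t)) ?_ ?_
    · intro s hs
      rcases Finset.mem_insert.1 hs with rfl | hs
      · simp [eval_finsetSum, ha, hD0]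
      · obtain ⟨ω, -, rfl⟩ := Finset.mem_image.1 hs
        simp only [eval_add, eval_mul, eval_C, hDz, mul_zero, zero_add, eval_finsetSum, eval_X]
        rw [Finset.sum_eq_single ω]
        · have := hLne ω
          have := ht0 ω
          simp only [hβ]
          field_simp
        · intro ω' _ h
          rw [hLz ω ω' h, mul_zero, mul_zero]
        · simp
    · rw [Finset.card_insert_of_notMem (by simpa using ht0), Finset.card_image_of_injective _ ht,
        Finset.card_univ, Nat.lt_succ_iff]
      refine max_le hq (natDegree_add_le_of_degree_le ((natDegree_C_mul_le _ _).trans hDdeg) ?_)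
      exact natDegree_sum_le_of_forall_le _ _ fun ω _ => (natDegree_C_mul_le _ _).trans (hXL ω)
  refine ⟨a, β, fun s hs => ?_⟩
  have hDs : ∏ ω, (s - t ω) = D.eval s := by simp [hD, eval_prod]
  have hDs0 : D.eval s ≠ 0 := by
    rw [← hDs]
    exact Finset.prod_ne_zero_iff.2 fun ω _ => sub_ne_zero.2 (hs ω)
  rw [hDs, key]
  simp only [eval_add, eval_mul, eval_C, eval_finsetSum, eval_X]
  rw [add_div, mul_div_cancel_right₀ _ hDs0, Finset.sum_div]
  congr 1
  refine Finset.sum_congr rfl fun ω _ => ?_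
  have hfac : D.eval s = (s - t ω) * (L ω).eval s := by
    rw [hD, ← Finset.mul_prod_erase _ _ (Finset.mem_univ ω)]
    simp [hL]
  have h1 := sub_ne_zero.2 (hs ω)
  have h2 : (L ω).eval s ≠ 0 := fun h => hDs0 (by rw [hfac, h, mul_zero])
  rw [hfac]
  field_simp

variable {N : ℕ} {ι : Type*} [Fintype ι]

/-- The reference measure: in every state, an atom at the level `0` and Lebesgue measure on the
positive levels. -/
noncomputable def refMeasure (N : ℕ) : Measure (ℝ × Fin N) :=
  (Measure.dirac (0 : ℝ) + volume.restrict (Set.Ioi 0)).prod Measure.count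

instance : SFinite (refMeasure N) := by unfold refMeasure; infer_instance

/-- The density, in the state `i`, of the complex measure with transform
`a i + ∑ ω, β i ω * s / (s - t ω)`. -/
noncomputable def refDensity (t : ι → ℂ) (a : Fin N → ℂ) (β : Fin N → ι → ℂ) (x : ℝ × Fin N) : ℂ :=
  if x.1 = 0 then a x.2 + ∑ ω, β x.2 ω
    else ∑ ω, β x.2 ω * (t ω * Complex.exp (t ω * (x.1 : ℂ)))

variable {t : ι → ℂ} {a : Fin N → ℂ} {β : Fin N → ι → ℂ}

lemma refMeasure_restrict (i : Fin N) : (refMeasure N).restrict {x | x.2 = i}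
    = (Measure.dirac (0 : ℝ) + volume.restrict (Set.Ioi 0)).map fun w => (w, i) := by
  have : {x : ℝ × Fin N | x.2 = i} = Set.univ ×ˢ {i} := by ext x; simp
  rw [this, refMeasure, ← Measure.prod_restrict, Measure.restrict_univ, Measure.restrict_singleton,
    Measure.count_singleton, one_smul, Measure.prod_dirac]

lemma ae_nonneg_refMeasure : ∀ᵐ x ∂refMeasure N, 0 ≤ x.1 := by
  refine (Measure.quasiMeasurePreserving_fst (μ := Measure.dirac (0 : ℝ)
    + volume.restrict (Set.Ioi 0)) (ν := (Measure.count : Measure (Fin N)))).ae ?_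
  rw [ae_add_measure_iff]
  refine ⟨?_, ?_⟩
  · rw [ae_dirac_eq]; exact le_refl (0 : ℝ)
  · exact (ae_restrict_mem measurableSet_Ioi).mono fun x hx => le_of_lt hx

lemma measurable_refDensity : Measurable (refDensity t a β) := by
  refine measurable_from_prod_countable_left fun i => ?_
  refine Measurable.ite (p := fun w : ℝ => w = 0) (measurableSet_singleton 0)
    (f := fun _ => a i + ∑ ω, β i ω) measurable_const ?_
  fun_prop

lemma integrableOn_refDensity (ht : ∀ ω, (t ω).re < 0) (i : Fin N) :
    IntegrableOn (fun w => refDensity t a β (w, i)) (Set.Ioi 0) := by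
  have h : IntegrableOn (fun w : ℝ => ∑ ω, β i ω * (t ω * Complex.exp (t ω * (w : ℂ))))
      (Set.Ioi 0) :=
    integrable_finsetSum _ fun ω _ =>
      ((integrableOn_exp_mul_complex_Ioi (ht ω) 0).const_mul _).const_mul _
  refine h.congr_fun (fun w hw => ?_) measurableSet_Ioi
  simp [refDensity, (ne_of_gt hw : w ≠ 0)]

lemma integrable_refDensity (ht : ∀ ω, (t ω).re < 0) :
    Integrable (refDensity t a β) (refMeasure N) := by
  rw [← sum_restrict_state measurable_snd (refMeasure N), integrable_finsetSum_measure]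
  intro i _
  rw [refMeasure_restrict, integrable_map_measure measurable_refDensity.aestronglyMeasurable
    (by fun_prop), integrable_add_measure]
  exact ⟨integrable_dirac (by simp), integrableOn_refDensity ht i⟩

lemma stateTransform_refDensity (ht : ∀ ω, (t ω).re < 0) (i : Fin N) {s : ℂ} (hs : 0 ≤ s.re) :
    stateTransform (refMeasure N) (refDensity t a β) i s
      = a i + ∑ ω, β i ω * (s / (s - t ω)) := by
  have hint := integrable_laplace (integrable_refDensity (a := a) (β := β) ht).restrict
    (s := s) (Y := Prod.fst) (by fun_prop)
    (ae_restrict_of_ae (s := {x : ℝ × Fin N | x.2 = i}) ae_nonneg_refMeasure) hs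
  have hm : Measurable fun w : ℝ => (w, i) := by fun_prop
  rw [refMeasure_restrict] at hint
  rw [stateTransform, laplace, refMeasure_restrict, integral_map hm.aemeasurable hint.1]
  rw [integrable_map_measure hint.1 hm.aemeasurable, integrable_add_measure] at hint
  simp only [Function.comp_def] at hint
  rw [integral_add_measure hint.1 hint.2, integral_dirac]
  have hexp : ∫ w in Set.Ioi (0 : ℝ), refDensity t a β (w, i) * Complex.exp (-s * (w : ℂ))
      = ∑ ω, β i ω * (t ω / (s - t ω)) := by
    have hre : ∀ ω, (t ω - s).re < 0 := fun ω => by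
      have := ht ω
      simp only [Complex.sub_re]; linarith
    calc _ = ∫ w in Set.Ioi (0 : ℝ), ∑ ω, β i ω * (t ω * Complex.exp ((t ω - s) * (w : ℂ))) := by
          refine setIntegral_congr_fun measurableSet_Ioi fun w hw => ?_
          simp only [refDensity, if_neg (ne_of_gt hw : w ≠ 0), Finset.sum_mul]
          refine Finset.sum_congr rfl fun ω _ => ?_
          rw [sub_mul, sub_eq_add_neg, Complex.exp_add, neg_mul]
          ring
      _ = ∑ ω, β i ω * (t ω * ∫ w in Set.Ioi (0 : ℝ), Complex.exp ((t ω - s) * (w : ℂ))) := by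
          rw [integral_finsetSum _ fun ω _ =>
            ((integrableOn_exp_mul_complex_Ioi (hre ω) 0).const_mul _).const_mul _]
          simp only [integral_const_mul]
      _ = _ := by
          refine Finset.sum_congr rfl fun ω _ => ?_
          have h1 : t ω - s ≠ 0 := fun h => by have := hre ω; simp [h] at this
          have h2 : s - t ω ≠ 0 := fun h => h1 (by rw [← neg_sub, h, neg_zero])
          rw [integral_exp_mul_complex_Ioi (hre ω)]
          simp only [Complex.ofReal_zero, mul_zero, Complex.exp_zero]
          congr 1
          rw [← neg_sub s (t ω), neg_div_neg_eq, mul_one_div]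
  rw [hexp]
  simp only [refDensity, if_true, Complex.ofReal_zero, mul_zero, Complex.exp_zero, mul_one,
    add_assoc, ← Finset.sum_add_distrib]
  congr 1
  refine Finset.sum_congr rfl fun ω _ => ?_
  have h2 : s - t ω ≠ 0 := fun h => by
    have := ht ω
    rw [← sub_eq_zero.1 h] at this
    exact this.not_ge hs
  field_simp
  ring

end PartialFractions

/-! ### The stationary law and its transform -/

section Stationary

variable {N : ℕ} {M : Model N}

lemma integral_levelExp {ρ : Measure (ℝ × Fin N)} (hρ : ∀ᵐ x ∂ρ, 0 ≤ x.1) (F : ℝ × Fin N → ℂ)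
    (j : Fin N) (s : ℂ) : ∫ x, F x * levelExp j s x ∂ρ = stateTransform ρ F j s := by
  have hj : MeasurableSet {x : ℝ × Fin N | x.2 = j} := measurable_snd (measurableSet_singleton j)
  rw [stateTransform, laplace, ← integral_indicator hj]
  refine integral_congr_ae ?_
  filter_upwards [hρ] with x hx
  by_cases h : x.2 = j <;> simp [levelExp, h, hx]

lemma lawTransform_eq_stateTransform (ν : Measure (ℝ × Fin N)) (j : Fin N) (s : ℂ) :
    lawTransform ν j s = stateTransform ν (fun _ => 1) j s := by
  simp [lawTransform, stateTransform, laplace]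

lemma lawTransform_eq_integral {ν : Measure (ℝ × Fin N)} (hν : ∀ᵐ x ∂ν, 0 ≤ x.1) (j : Fin N)
    (s : ℂ) : lawTransform ν j s = ∫ x, levelExp j s x ∂ν := by
  rw [lawTransform_eq_stateTransform, ← integral_levelExp hν]
  simp

lemma IsProcess.ae_nonneg {Ω : Type*} [MeasurableSpace Ω] {μ : Measure Ω} {W : ℕ → Ω → ℝ}
    {Z : ℕ → Ω → Fin N} {V S A : ℕ → Ω → ℝ} (h : IsProcess M μ W Z V S A) (n : ℕ) :
    ∀ᵐ ω ∂μ, 0 ≤ W n ω := by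
  cases n with
  | zero => exact h.nonneg_init
  | succ n => exact .of_forall fun ω => by rw [h.recursion]; exact le_max_right _ _

lemma IsProcess.transform_eq_integral {Ω : Type*} [MeasurableSpace Ω] {μ : Measure Ω}
    {W : ℕ → Ω → ℝ} {Z : ℕ → Ω → Fin N} {V S A : ℕ → Ω → ℝ} (h : IsProcess M μ W Z V S A)
    (n : ℕ) (j : Fin N) (s : ℂ) :
    transform μ W Z n j s = ∫ x, levelExp j s x ∂chainLaw μ W Z n := by
  have hj : MeasurableSet {ω | Z n ω = j} := h.measurable_Z n (measurableSet_singleton j)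
  rw [chainLaw, integral_map (h.measurable_pair n).aemeasurable
    (measurable_levelExp j s).aestronglyMeasurable, transform, ← integral_indicator hj]
  refine integral_congr_ae ?_
  filter_upwards [h.ae_nonneg n] with ω hω
  by_cases hZ : Z n ω = j <;> simp [levelExp, hZ, hω]

variable {z : ℝ × Fin N} {n₀ : ℕ} {ε : ℝ} {ν : Measure (ℝ × Fin N)} [IsProbabilityMeasure ν]

/-- Convergence to the stationary law, tested against a bounded complex function. -/
lemma Doeblin.tendsto_integral_complex (hD : Doeblin M.kernel z n₀ ε) (hν : ν.bind M.kernel = ν)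
    (α : Measure (ℝ × Fin N)) [IsProbabilityMeasure α] {f : ℝ × Fin N → ℂ} (hf : Measurable f)
    (hf1 : ∀ x, ‖f x‖ ≤ 1) :
    Tendsto (fun n => ∫ x, f x ∂((fun β : Measure (ℝ × Fin N) => β.bind M.kernel)^[n] α)) atTop
      (𝓝 (∫ x, f x ∂ν)) := by
  have hre : ∀ x, (f x).re ∈ Set.Icc (-1 : ℝ) 1 := fun x =>
    abs_le.1 ((Complex.abs_re_le_norm _).trans (hf1 x))
  have him : ∀ x, (f x).im ∈ Set.Icc (-1 : ℝ) 1 := fun x =>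
    abs_le.1 ((Complex.abs_im_le_norm _).trans (hf1 x))
  have hmre : Measurable fun x => (f x).re := Complex.measurable_re.comp hf
  have hmim : Measurable fun x => (f x).im := Complex.measurable_im.comp hf
  have hsplit : ∀ β : Measure (ℝ × Fin N), IsFiniteMeasure β → ∫ x, f x ∂β
      = ((∫ x, (f x).re ∂β : ℝ) : ℂ) + ((∫ x, (f x).im ∂β : ℝ) : ℂ) * Complex.I := by
    intro β _
    have hi : Integrable f β := Integrable.of_bound hf.aestronglyMeasurable 1 (.of_forall hf1)
    exact (integral_re_add_im hi).symm
  rw [hsplit ν inferInstance]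
  have h₁ := hD.tendsto_integral hν α hmre hre
  have h₂ := hD.tendsto_integral hν α hmim him
  refine (((Complex.continuous_ofReal.tendsto _).comp h₁).add
    (((Complex.continuous_ofReal.tendsto _).comp h₂).mul_const Complex.I)).congr fun n => ?_
  obtain ⟨hfin, hint⟩ := integral_iterate_bind (κ := M.kernel) (α := α) hmre hre n
  rw [hsplit _ hfin, hint, (integral_iterate_bind (κ := M.kernel) (α := α) hmim him n).2]
  rfl

/-- The background component of the stationary law is the stationary vector of the background
chain: both are limits of the entries of `M.P ^ k`. -/
lemma Doeblin.lawTransform_zero (hD : Doeblin M.kernel z n₀ ε) (hν : ν.bind M.kernel = ν)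
    {p : Fin N → ℝ} (hp : IsStationaryVector M.P p) (j : Fin N) : lawTransform ν j 0 = p j := by
  obtain ⟨⟨hp0, hp1⟩, hpP⟩ := hp
  have hiter : ∀ k, Matrix.vecMul p (M.P ^ k) = p := by
    intro k
    induction k with
    | zero => simp
    | succ k ih => rw [pow_succ, ← Matrix.vecMul_vecMul, ih, hpP]
  set h : Fin N → ℝ := Pi.single j 1 with hh
  have hab : ∀ x : ℝ × Fin N, h x.2 ∈ Set.Icc (0 : ℝ) 1 := fun x => by
    by_cases hx : x.2 = j <;> simp [hh, hx]
  have hlim : ∀ i, Tendsto (fun k => (M.P ^ k) i j) atTop (𝓝 (∫ x, h x.2 ∂ν)) := by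
    intro i
    refine (hD.tendsto_integral hν (Measure.dirac ((0 : ℝ), i)) (measurable_state h) hab).congr
      fun k => ?_
    rw [integral_dirac, M.iterate_transOp_state]
    simp [hh]
  have hlim' : Tendsto (fun k => ∑ i, p i * (M.P ^ k) i j) atTop
      (𝓝 (∑ i, p i * ∫ x, h x.2 ∂ν)) :=
    tendsto_finsetSum _ fun i _ => (hlim i).const_mul _
  have hconst : ∀ k, ∑ i, p i * (M.P ^ k) i j = p j := fun k => congrFun (hiter k) j
  simp only [hconst, ← Finset.sum_mul, hp1, one_mul] at hlim'
  rw [tendsto_nhds_unique tendsto_const_nhds hlim']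
  have hj : MeasurableSet {x : ℝ × Fin N | x.2 = j} := measurable_snd (measurableSet_singleton j)
  have hind : ∀ x : ℝ × Fin N, h x.2 = Set.indicator {x : ℝ × Fin N | x.2 = j} 1 x := fun x => by
    by_cases hx : x.2 = j <;> simp [hh, hx]
  simp only [hind]
  rw [integral_indicator_one hj]
  simp [lawTransform]

section Coefficients

variable {m : Fin N → ℕ}

/-- The function `numer c j` as a polynomial. -/
noncomputable def numerPoly (c : Fin N → Fin ((∑ k, m k) + 1) → ℂ) (j : Fin N) : Polynomial ℂ :=
  ∑ ω : Fin ((∑ k, m k) + 1), Polynomial.C (c j ω) * Polynomial.X ^ (ω : ℕ)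

variable (c : Fin N → Fin ((∑ k, m k) + 1) → ℂ) (j : Fin N)

lemma numer_eq_eval (s : ℂ) : numer c j s = (numerPoly c j).eval s := by
  simp [numer, numerPoly, Polynomial.eval_finsetSum]

lemma natDegree_numerPoly : (numerPoly c j).natDegree ≤ ∑ k, m k :=
  Polynomial.natDegree_sum_le_of_forall_le _ _ fun ω _ =>
    (Polynomial.natDegree_C_mul_X_pow_le _ _).trans (Nat.lt_succ_iff.1 ω.2)

lemma coeff_numerPoly (ω : Fin ((∑ k, m k) + 1)) : (numerPoly c j).coeff ω = c j ω := by
  rw [numerPoly, Polynomial.finsetSum_coeff, Finset.sum_eq_single ω]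
  · simp
  · intro ω' _ h
    rw [Polynomial.coeff_C_mul_X_pow, if_neg fun h' => h (Fin.ext h').symm]
  · simp

lemma numer_zero : numer c j 0 = c j 0 := by
  rw [numer_eq_eval, ← Polynomial.coeff_zero_eq_eval_zero, ← coeff_numerPoly c j 0]
  rfl

lemma exists_numer_eq {q : Fin N → Polynomial ℂ} (hq : ∀ j, (q j).natDegree ≤ ∑ k, m k) :
    ∃ c : Fin N → Fin ((∑ k, m k) + 1) → ℂ, ∀ j s, numer c j s = (q j).eval s := by
  refine ⟨fun j ω => (q j).coeff ω, fun j s => ?_⟩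
  rw [numer, Polynomial.eval_eq_sum_range' (Nat.lt_succ_of_le (hq j)), Finset.sum_range]

end Coefficients

variable {m : Fin N → ℕ} {t : (k : Fin N) → Fin (m k) → ℂ} {num : Fin N → Polynomial ℂ}

/-- The transform of the stationary law is rational, with coefficients that solve the linear
system. -/
lemma exists_numer_stationary (hrat : HasRationalService M num t) (hV : ∀ᵐ v ∂M.lawV, v < 0)
    (hν : ν.bind M.kernel = ν) :
    ∃ c : Fin N → Fin ((∑ k, m k) + 1) → ℂ,
      (∀ (j : Fin N) (s : ℂ), 0 ≤ s.re → lawTransform ν j s = numer c j s / ∏ k, denom t k s) ∧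
      PoleSystem M num t c := by
  have hν0 := M.ae_nonneg_of_invariant hν
  choose q hdeg hq hqt using Model.exists_numerator hrat hV
    (integrable_const (1 : ℂ) : Integrable (fun _ : ℝ × Fin N => (1 : ℂ)) ν) hν0
  obtain ⟨c, hc⟩ := exists_numer_eq hdeg
  have hstep : ∀ (j : Fin N) (s : ℂ), 0 ≤ s.re →
      ∫ x, (1 : ℂ) * ∫ y, levelExp j s y ∂M.step x ∂ν = lawTransform ν j s := by
    intro j s hs
    rw [lawTransform_eq_integral hν0]
    have hi : Integrable (levelExp j s) (ν.bind M.kernel) := by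
      rw [hν]
      exact Integrable.of_bound (measurable_levelExp j s).aestronglyMeasurable 1
        (.of_forall (norm_levelExp_le j hs))
    conv_rhs => rw [← hν, integral_bind_of_integrable hi]
    simp only [one_mul]
    rfl
  have hlaw : ∀ (j : Fin N) (s : ℂ), 0 ≤ s.re →
      lawTransform ν j s = numer c j s / ∏ k, denom t k s := by
    intro j s hs
    rw [hc, ← hq j s hs, hstep j s hs, mul_div_cancel_right₀]
    rw [prod_denom_eq_eval]
    exact fullDenom_ne_zero hrat.1 hs
  refine ⟨c, hlaw, fun k f j => ?_⟩
  rw [hc, hqt]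
  congr 1
  refine Finset.sum_congr rfl fun i _ => ?_
  congr 1
  refine setIntegral_congr_fun measurableSet_Iio fun y (hy : y < 0) => ?_
  have hre : 0 ≤ (t k f * (y : ℂ)).re := by
    rw [Complex.re_mul_ofReal]
    exact mul_nonneg_of_nonpos_of_nonpos (hrat.1 k f).le hy.le
  rw [← lawTransform_eq_stateTransform, hlaw i _ hre]

/-- If the zeros of the denominators are distinct, every solution of the linear system yields the
transform of the stationary law: by partial fractions the solution is the transform of a complex
measure; one step of the chain reproduces this measure, because the two numerators are polynomials
of degree at most `∑ k, m k` that agree at the zeros and at `0`. -/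
lemma PoleSystem.numer_eq (hrat : HasRationalService M num t) (hV : ∀ᵐ v ∂M.lawV, v < 0)
    (hD : Doeblin M.kernel z n₀ ε) (hν : ν.bind M.kernel = ν)
    {p : Fin N → ℝ} (hp : IsStationaryVector M.P p)
    (hinj : Function.Injective fun x : (k : Fin N) × Fin (m k) => t x.1 x.2)
    {c : Fin N → Fin ((∑ k, m k) + 1) → ℂ} (hc0 : ∀ j, c j 0 = (p j : ℂ) * ∏ k, denom t k 0)
    (hc : PoleSystem M num t c) (j : Fin N) (n : ℕ) :
    numer c j n = lawTransform ν j n * ∏ k, denom t k n := by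
  have ht := hrat.1
  set τ : (k : Fin N) × Fin (m k) → ℂ := fun x => t x.1 x.2 with hτ
  have hτre : ∀ ω, (τ ω).re < 0 := fun ω => ht ω.1 ω.2
  have hτ0 : ∀ ω, τ ω ≠ 0 := fun ω h => by
    have := hτre ω
    simp [h] at this
  have hcard : Fintype.card ((k : Fin N) × Fin (m k)) = ∑ k, m k := by simp
  have hprod : ∀ s, ∏ k, denom t k s = ∏ ω, (s - τ ω) := fun s => by
    rw [Fintype.prod_sigma]; rfl
  choose a β hpf using fun i => exists_partial_fractions (t := τ) hinj hτ0
    ((natDegree_numerPoly c i).trans hcard.ge)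
  set F := refDensity τ a β with hFdef
  have hF : Integrable F (refMeasure N) := integrable_refDensity hτre
  have hρ := ae_nonneg_refMeasure (N := N)
  have hΦ : ∀ (i : Fin N) (s : ℂ), 0 ≤ s.re →
      stateTransform (refMeasure N) F i s = numer c i s / ∏ k, denom t k s := by
    intro i s hs
    rw [hFdef, stateTransform_refDensity hτre i hs, numer_eq_eval, hprod, hpf i s]
    rintro ω rfl
    exact (hτre ω).not_ge hs
  have hΦ0 : ∀ i, stateTransform (refMeasure N) F i 0 = p i := by
    intro i
    rw [hΦ i 0 le_rfl, numer_zero, hc0, mul_div_cancel_right₀]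
    rw [prod_denom_eq_eval]
    exact fullDenom_ne_zero ht le_rfl
  have hstep : ∀ (j : Fin N) (s : ℂ), 0 ≤ s.re →
      ∫ x, F x * ∫ y, levelExp j s y ∂M.step x ∂refMeasure N
        = stateTransform (refMeasure N) F j s := by
    intro j s hs
    obtain ⟨q, hdeg, hq, hqt⟩ := Model.exists_numerator hrat hV hF hρ j
    -- Both polynomials have degree at most `∑ k, m k`, and they agree at `∑ k, m k + 1` points.
    have hqn : q = numerPoly c j := by
      classical
      refine Polynomial.eq_of_natDegree_lt_card_of_eval_eq' _ _
        (insert 0 (Finset.univ.image τ)) ?_ ?_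
      · intro r hr
        rcases Finset.mem_insert.1 hr with rfl | hr
        · rw [← hq 0 le_rfl, M.integral_step_eq_sum_posPart hF j le_rfl, ← numer_eq_eval,
            numer_zero, hc0]
          congr 1
          have hpos : ∀ i, M.posPart (refMeasure N) F i j 0 = p i := by
            intro i
            rw [← hΦ0 i, Model.posPart, stateTransform, laplace, laplace, Model.stepLaw]
            simp only [neg_zero, zero_mul, Complex.exp_zero, mul_one]
            rw [integral_fun_fst]
            simp
          simp only [hpos]
          have := congrFun hp.2 j
          simp only [Matrix.vecMul, dotProduct] at this
          rw [← this]
          push_cast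
          exact Finset.sum_congr rfl fun i _ => mul_comm _ _
        · obtain ⟨⟨k, f⟩, -, rfl⟩ := Finset.mem_image.1 hr
          simp only [hτ]
          rw [hqt, ← numer_eq_eval, ← hc k f j]
          congr 1
          refine Finset.sum_congr rfl fun i _ => ?_
          congr 1
          refine setIntegral_congr_fun measurableSet_Iio fun y (hy : y < 0) => ?_
          refine hΦ i _ ?_
          rw [Complex.re_mul_ofReal]
          exact mul_nonneg_of_nonpos_of_nonpos (ht k f).le hy.le
      · rw [Finset.card_insert_of_notMem (by
            rintro h
            obtain ⟨ω, -, hω⟩ := Finset.mem_image.1 h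
            exact hτ0 ω hω),
          Finset.card_image_of_injective _ hinj, Finset.card_univ, hcard, Nat.lt_succ_iff]
        exact max_le hdeg (natDegree_numerPoly c j)
    have hne : ∏ k, denom t k s ≠ 0 := by
      rw [prod_denom_eq_eval]
      exact fullDenom_ne_zero ht hs
    rw [hΦ j s hs, numer_eq_eval, ← hqn, ← hq s hs, mul_div_cancel_right₀ _ hne]
  -- At natural numbers the transform is the integral of a real test function.
  have hnat : ∀ k : ℕ, 0 ≤ ((k : ℂ)).re := fun k => by simp
  have htrans : ∀ (j : Fin N) (k : ℕ) (x : ℝ × Fin N),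
      (transOp M.kernel (expTest j k) x : ℂ) = ∫ y, levelExp j k y ∂M.step x := by
    intro j k x
    rw [transOp, ← integral_complex_ofReal]
    simp only [ofReal_expTest]
    rfl
  have hinv : ∀ (j : Fin N) (k : ℕ), ∫ x, F x * (expTest j k x : ℂ) ∂refMeasure N
      = ∫ x, F x * (transOp M.kernel (expTest j k) x : ℂ) ∂refMeasure N := by
    intro j k
    simp only [htrans, ofReal_expTest]
    rw [hstep j k (hnat k), integral_levelExp hρ]
  have hmass : ∫ x, F x ∂refMeasure N = 1 := by
    conv_lhs => rw [← sum_restrict_state measurable_snd (refMeasure N)]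
    rw [integral_finsetSum_measure fun i _ => hF.restrict]
    have : ∀ i, ∫ x in {x : ℝ × Fin N | x.2 = i}, F x ∂refMeasure N = p i := fun i => by
      rw [← hΦ0 i]; simp [stateTransform, laplace]
    simp only [this]
    exact_mod_cast hp.1.2
  have h := integral_eq_of_expTest hD hV hν hF hρ hinv (isTest_expTest j n)
  simp only [ofReal_expTest] at h
  rw [hmass, one_mul, integral_levelExp hρ, hΦ j n (hnat n), ← integral_complex_ofReal] at h
  simp only [ofReal_expTest] at h
  rw [lawTransform_eq_integral (M.ae_nonneg_of_invariant hν), ← h, div_mul_cancel₀]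
  rw [prod_denom_eq_eval]
  exact fullDenom_ne_zero ht (hnat n)

end Stationary

end MarkovLindley

open MarkovLindley

theorem mainTheorem2 {N : ℕ} (M : MarkovLindley.Model N)
    (hirr : M.P.IsIrreducible) (haper : MarkovLindley.Aperiodic M.P)
    (p : Fin N → ℝ) (hp : MarkovLindley.IsStationaryVector M.P p)
    (hV : ∀ᵐ v ∂M.lawV, v < 0)
    (hstable : ∃ i l : Fin N, 0 < M.P i l ∧
      0 < ((M.lawS i).prod (M.lawA l)) {x : ℝ × ℝ | x.1 < x.2})
    (m : Fin N → ℕ) (t : (k : Fin N) → Fin (m k) → ℂ) (num : Fin N → Polynomial ℂ)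
    (hrat : MarkovLindley.HasRationalService M num t)
    {Ω : Type*} [MeasurableSpace Ω] (μ : Measure Ω) [IsProbabilityMeasure μ]
    (W : ℕ → Ω → ℝ) (Z : ℕ → Ω → Fin N) (V S A : ℕ → Ω → ℝ)
    (hproc : MarkovLindley.IsProcess M μ W Z V S A) :
    ∃ ν : Measure (ℝ × Fin N),
      M.IsStationaryLaw ν ∧ (∀ ν', M.IsStationaryLaw ν' → ν' = ν) ∧
      (∀ (j : Fin N) (s : ℂ), 0 ≤ s.re →
        Tendsto (fun n => MarkovLindley.transform μ W Z n j s) atTop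
          (𝓝 (MarkovLindley.lawTransform ν j s))) ∧
      ∃ c : Fin N → Fin ((∑ k, m k) + 1) → ℂ,
        (∀ (j : Fin N) (s : ℂ), 0 ≤ s.re →
          MarkovLindley.lawTransform ν j s
            = MarkovLindley.numer c j s / ∏ k : Fin N, MarkovLindley.denom t k s) ∧
        (∀ j : Fin N, c j 0 = (p j : ℂ) * ∏ k : Fin N, MarkovLindley.denom t k 0) ∧
        MarkovLindley.PoleSystem M num t c ∧
        (Function.Injective (fun x : (k : Fin N) × Fin (m k) => t x.1 x.2) →
          ∀ c' : Fin N → Fin ((∑ k, m k) + 1) → ℂ,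
            (∀ j : Fin N, c' j 0 = (p j : ℂ) * ∏ k : Fin N, MarkovLindley.denom t k 0) →
            MarkovLindley.PoleSystem M num t c' → c' = c) := by
  obtain ⟨z, n₀, ε, hn₀, hD⟩ := M.exists_doeblin hirr haper hV hstable
  obtain ⟨ν, hνp, hν⟩ := hD.exists_invariant hn₀
  have hν0 := M.ae_nonneg_of_invariant hν
  obtain ⟨c, hlaw, hc⟩ := exists_numer_stationary hrat hV hν
  have hne : ∏ k, denom t k 0 ≠ 0 := by
    rw [prod_denom_eq_eval]
    exact fullDenom_ne_zero hrat.1 le_rfl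
  have hc0 : ∀ j, c j 0 = (p j : ℂ) * ∏ k, denom t k 0 := fun j => by
    rw [← hD.lawTransform_zero hν hp j, hlaw j 0 le_rfl, numer_zero, div_mul_cancel₀ _ hne]
  refine ⟨ν, (M.isStationaryLaw_iff ν).2 ⟨hνp, hν⟩, fun ν' hν' => ?_, fun j s hs => ?_, c, hlaw,
    hc0, hc, fun hinj c' hc0' hc' => ?_⟩
  · obtain ⟨_, h'⟩ := (M.isStationaryLaw_iff ν').1 hν'
    exact hD.invariant_unique hν h'
  · rw [lawTransform_eq_integral hν0]
    have : IsProbabilityMeasure (chainLaw μ W Z 0) :=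
      Measure.isProbabilityMeasure_map (hproc.measurable_pair 0).aemeasurable
    refine (hD.tendsto_integral_complex hν (chainLaw μ W Z 0) (measurable_levelExp j s)
      (norm_levelExp_le j hs)).congr fun n => ?_
    rw [hproc.transform_eq_integral, hproc.chainLaw_eq_iterate n]
  · -- The numerators agree at all natural numbers, so they are equal as polynomials.
    have hpoly : ∀ j, numerPoly c' j = numerPoly c j := fun j => by
      refine Polynomial.eq_of_infinite_eval_eq _ _
        ((Set.infinite_range_of_injective (Nat.cast_injective (R := ℂ))).mono ?_)
      rintro _ ⟨n, rfl⟩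
      rw [Set.mem_ofPred_eq, ← numer_eq_eval, ← numer_eq_eval,
        hc'.numer_eq hrat hV hD hν hp hinj hc0', hc.numer_eq hrat hV hD hν hp hinj hc0]
    funext j ω
    rw [← coeff_numerPoly c' j ω, hpoly, coeff_numerPoly]
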